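/- **Setting.** Consider the system $x_{t+1}=A x_t+B u_t+w_t$, $y_t=C x_t+e_t$, $x_1=0$, with arbitrary fixed disturbances, and write $v_t=(y_t,u_t)\in\mathbb R^{d_y+d_u}$. It is run with a nominal controller $\pi_0$ that accepts exogenous inputs $u^{\rm ex}_t$ and emits a signal $\eta_t\in\mathbb R^{d_\eta}$: $s_{t+1}=A_0 s_t+B_0 y_t+B_{0,u}u^{\rm ex}_t$, $u_t=C_0 s_t+D_0 y_t+u^{\rm ex}_t$, $\eta_t=C_\eta s_t+D_\eta y_t$, $s_1=0$. Let $v^{\rm nat}_t,\eta^{\rm nat}_t$ be the values for $u^{\rm ex}\equiv 0$, and let $G_{{\rm ex}\to v},G_{{\rm ex}\to\eta}$ be the closed-loop Markov operators, so that $v_t=v^{\rm nat}_t+\sum_{i\le t}G_{{\rm ex}\to v}^{[t-i]}u^{\rm ex}_i$, and likewise for $\eta$. For a Markov operator put $\|G\|_{\ell_1,\rm op}=\sum_{i\ge0}\|G^{[i]}\|_{\rm op}$ and $\psi_G(n)=\sum_{i\ge n}\|G^{[i]}\|_{\rm op}$. A decay function is a nonnegative, nonincreasing function $\mathbb N\to\mathbb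 R$. **Assumptions.** The losses $\ell_t:\mathbb R^{d_y+d_u}\to\mathbb R$ are convex, differentiable, with $0\le\ell_t(v)\le L\max\{1,\|v\|^2\}$ and $\|\nabla\ell_t(v)\|\le L\max\{1,\|v\|\}$. Both $G\in\{G_{{\rm ex}\to v},G_{{\rm ex}\to\eta}\}$ satisfy $\|G\|_{\ell_1,\rm op}\le R_{\pi_0}<\infty$ and $\psi_G\le\psi_{\pi_0}$ for a decay function $\psi_{\pi_0}$. For all $t$, $\|v^{\rm nat}_t\|,\|\eta^{\rm nat}_t\|\le R_{\rm nat}$. Also $R_{\rm nat},R_{\mathcal M}\ge1$, $T,m\ge1$, $c\ge1$, $\delta\in(0,1)$, $N\ge m+h$, and for some $m_\star\in\mathbb N$ and a decay function $\psi_\star$: $$R_{\mathcal M}\ge2R_\star,\quad m\ge2m_\star+h,\quad \psi_{\pi_0}(h+1)\le \frac{cR_{\pi_0}}{T},\quad \psi_\star(m_\star)\le\frac{cR_\star}{T}.$$ **Benchmark.** $\Pi_\star$ is the set of linear dynamic controllers $\pi$ (of any finite state dimension, started at zero) that have a conversion operator $G_{\pi_0\to\pi}$ with $\|G_{\pi_0\to\pi}\|_{\ell_1,\rm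 op}\le R_\star$ and $\psi_{G_{\pi_0\to\pi}}\le\psi_\star$; a conversion operator is a Markov operator such that the exogenous inputs $\sum_{i\le t}G_{\pi_0\to\pi}^{[t-i]}\eta^{\rm nat}_i$ make the nominal closed loop reproduce the sequence $v^\pi_t$ obtained by executing $\pi$, for all $t$. Assume $\Pi_\star\neq\emptyset$. **Algorithm.** In rounds $t\le N$ the algorithm plays exploration inputs $u^{\rm ex}_t$. It then has estimates $\widehat G_{{\rm ex}\to v},\widehat G_{{\rm ex}\to\eta}$, truncated after lag $h$ (for each lag beyond $h$ the exact Markov parameter is also allowed). For $t>N$ it plays $u^{\rm ex}_t=\sum_{i=0}^{m-1}M_t^{[i]}\widehat\eta^{\,\rm nat}_{t-i}$, where $\widehat\eta^{\,\rm nat}_t=\eta_t-\sum_{i<t}\widehat G_{{\rm ex}\to\eta}^{[t-i]}u^{\rm ex}_i$ (zero for $t\le0$), and the iterates $M_t\in\mathcal M=\{M:\sum_{i<m}\|M^{[i]}\|_{\rm op}\le R_{\mathcal M}\}$ are produced by an arbitrary black-box procedure. Let $\mathfrak e(M)$ be the vectorization of $M$, $\mathcal M_{\mathfrak e}=\mathfrak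 e(\mathcal M)$, $\mathbf z_t=\mathfrak e(M_t)$, and let $\mathbf Y_t$ be the matrix with $\mathbf Y_t\,\mathfrak e(M)=\sum_{i<m}M^{[i]}\widehat\eta^{\,\rm nat}_{t-i}$ for every $M$. Put $F_t(z_{t:t-h})=\ell_t\big(v^{\rm nat}_t+\sum_{i=0}^hG_{{\rm ex}\to v}^{[i]}\mathbf Y_{t-i}z_{t-i}\big)$, $f_t(z)=F_t(z,\dots,z)$, and $$\mathrm{ControlReg}_T=\sum_{t=1}^T\ell_t(v_t)-\inf_{\pi\in\Pi_\star}\sum_{t=1}^T\ell_t(v^\pi_t),\qquad \widehat{\mathrm{MemoryReg}}_T(z_\star)=\sum_{t=N+m+2h+1}^T\big(F_t(\mathbf z_{t:t-h})-f_t(z_\star)\big).$$ **Estimation event.** With $R_{u,\rm est}=3\sqrt{d_u+\log(1/\delta)}$, suppose that $\|u^{\rm ex}_t\|\le R_{u,\rm est}$ for $t\le N$, that $\|\widehat G_{{\rm ex}\to v}-G_{{\rm ex}\to v}\|_{\ell_1,\rm op}\le\epsilon_G$ and $\|\widehat G_{{\rm ex}\to\eta}-G_{{\rm ex}\to\eta}\|_{\ell_1,\rm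 op}\le\epsilon_G$, and that $\epsilon_G\le1/\max\{R_{u,\rm est},2R_{\mathcal M}R_{\pi_0}\}$. **Claim.** There is a universal constant $K_0>0$ such that in this situation there exists $z_\star\in\mathcal M_{\mathfrak e}$ such that, for every $\nu>0$, $$\begin{aligned}\mathrm{ControlReg}_T\le{}&\widehat{\mathrm{MemoryReg}}_T(z_\star)+\nu\sum_{t=N+m+2h+1}^T\|\mathbf Y_t(\mathbf z_t-z_\star)\|_2^2\\&+K_0LR_{\pi_0}^3(N+cm)\big(d_u+\log(1/\delta)+R_{\mathcal M}^4R_{\rm nat}^2\big)\\&+K_0LR_{\mathcal M}^3R_{\pi_0}^2R_{\rm nat}^2\,T\epsilon_G^2\Big(1+\frac{LmR_{\pi_0}^2}{\nu}\Big).\end{aligned}$$ The same holds for the static version of the algorithm, where $\pi_0$ is static feedback $u_t=Ky_t+u^{\rm ex}_t$, $\eta_t=y_t$, and a single estimate $\widehat G$ of $G_K=G_{{\rm ex}\to v}$ with $\|\widehat G-G_K\|_{\ell_1,\rm op}\le\epsilon_G$ is used, its $y$-rows serving as $\widehat G_{{\rm ex}\to\eta}$. -/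

import Mathlib

-- On matrices, `‖A‖` is the operator norm induced by the Euclidean norms.
open scoped Matrix.Norms.L2Operator

noncomputable section

namespace NonstochasticControl

/-! Time is indexed from `0`: index `t` stands for round `t + 1`, so that the rounds `1, …, T`
are the indices `t < T`, and the rounds `a + 1, …, T` are the indices `a ≤ t < T`. -/

/-- Euclidean space of dimension `n`. -/
abbrev Vec (n : ℕ) : Type := EuclideanSpace ℝ (Fin n)

/-- The space of the stacked vectors `v = (y, u)`, with the Euclidean norm. -/
abbrev VecYU (dy du : ℕ) : Type := EuclideanSpace ℝ (Fin dy ⊕ Fin du)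

/-- The stacked vector `(y, u)`. -/
def stack {dy du : ℕ} (y : Vec dy) (u : Vec du) : VecYU dy du :=
  WithLp.toLp 2 (Sum.elim (fun i => y i) (fun i => u i))

/-- Matrix-vector product on Euclidean spaces. -/
def act {ι κ : Type} [Fintype ι] [Fintype κ] (A : Matrix ι κ ℝ) (x : EuclideanSpace ℝ κ) :
    EuclideanSpace ℝ ι :=
  WithLp.toLp 2 (A.mulVec x.ofLp)

infixr:73 " *ₑ " => act

/-! ### Systems and controllers -/

/-- The system `x_{t+1} = A x_t + B u_t + w_t`, `y_t = C x_t + e_t`. -/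
structure LinearSystem (dx dy du : ℕ) where
  A : Matrix (Fin dx) (Fin dx) ℝ
  B : Matrix (Fin dx) (Fin du) ℝ
  C : Matrix (Fin dy) (Fin dx) ℝ

/-- A nominal controller `π₀`, which accepts exogenous inputs `uᵉˣ` and emits a signal `η`:
`s_{t+1} = A s_t + B y_t + Bu uᵉˣ_t`, `u_t = C s_t + D y_t + uᵉˣ_t`, `η_t = Cη s_t + Dη y_t`. -/
structure NominalController (ds dy du dη : ℕ) where
  A : Matrix (Fin ds) (Fin ds) ℝ
  B : Matrix (Fin ds) (Fin dy) ℝ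
  Bu : Matrix (Fin ds) (Fin du) ℝ
  C : Matrix (Fin du) (Fin ds) ℝ
  D : Matrix (Fin du) (Fin dy) ℝ
  Cη : Matrix (Fin dη) (Fin ds) ℝ
  Dη : Matrix (Fin dη) (Fin dy) ℝ

/-- Static feedback `u_t = K y_t + uᵉˣ_t`, with `η_t = y_t`. -/
def NominalController.static {dy du : ℕ} (K : Matrix (Fin du) (Fin dy) ℝ) :
    NominalController 0 dy du dy where
  A := 0
  B := 0
  Bu := 0
  C := 0
  D := K
  Cη := 0
  Dη := 1

/-- A linear dynamic controller `s_{t+1} = A s_t + B y_t`, `u_t = C s_t + D y_t`. -/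
structure LDC (dy du : ℕ) where
  dim : ℕ
  A : Matrix (Fin dim) (Fin dim) ℝ
  B : Matrix (Fin dim) (Fin dy) ℝ
  C : Matrix (Fin du) (Fin dim) ℝ
  D : Matrix (Fin du) (Fin dy) ℝ

/-- A control instance: the system, the nominal controller, the disturbances and the losses. -/
structure Instance (dx ds dy du dη : ℕ) where
  sys : LinearSystem dx dy du
  ctrl : NominalController ds dy du dη
  w : ℕ → Vec dx
  e : ℕ → Vec dy
  loss : ℕ → VecYU dy du → ℝ

variable {dx ds dy du dη : ℕ}

namespace Instance

/-- State `(x_t, s_t)` of the system in feedback with the nominal controller, when the exogenous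
inputs are `uex`; it starts at zero. -/
def state (P : Instance dx ds dy du dη) (uex : ℕ → Vec du) : ℕ → Vec dx × Vec ds
  | 0 => (0, 0)
  | t + 1 =>
    let x := (state P uex t).1
    let s := (state P uex t).2
    let y := P.sys.C *ₑ x + P.e t
    let u := P.ctrl.C *ₑ s + P.ctrl.D *ₑ y + uex t
    (P.sys.A *ₑ x + P.sys.B *ₑ u + P.w t, P.ctrl.A *ₑ s + P.ctrl.B *ₑ y + P.ctrl.Bu *ₑ uex t)

/-- The output `y_t` under exogenous inputs `uex`. -/
def y (P : Instance dx ds dy du dη) (uex : ℕ → Vec du) (t : ℕ) : Vec dy :=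
  P.sys.C *ₑ (P.state uex t).1 + P.e t

/-- The input `u_t` under exogenous inputs `uex`. -/
def u (P : Instance dx ds dy du dη) (uex : ℕ → Vec du) (t : ℕ) : Vec du :=
  P.ctrl.C *ₑ (P.state uex t).2 + P.ctrl.D *ₑ P.y uex t + uex t

/-- The stacked vector `v_t = (y_t, u_t)` under exogenous inputs `uex`. -/
def v (P : Instance dx ds dy du dη) (uex : ℕ → Vec du) (t : ℕ) : VecYU dy du :=
  stack (P.y uex t) (P.u uex t)

/-- The controller signal `η_t` under exogenous inputs `uex`. -/
def η (P : Instance dx ds dy du dη) (uex : ℕ → Vec du) (t : ℕ) : Vec dη :=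
  P.ctrl.Cη *ₑ (P.state uex t).2 + P.ctrl.Dη *ₑ P.y uex t

/-- Nature's `v`: no exogenous input. -/
def vNat (P : Instance dx ds dy du dη) : ℕ → VecYU dy du := P.v 0

/-- Nature's `η`: no exogenous input. -/
def ηNat (P : Instance dx ds dy du dη) : ℕ → Vec dη := P.η 0

/-- State `(x_t, s_t)` when the LDC `π` is executed on the system instead. -/
def ldcState (P : Instance dx ds dy du dη) (π : LDC dy du) : ℕ → Vec dx × Vec π.dim
  | 0 => (0, 0)
  | t + 1 =>
    let x := (ldcState P π t).1
    let s := (ldcState P π t).2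
    let y := P.sys.C *ₑ x + P.e t
    let u := π.C *ₑ s + π.D *ₑ y
    (P.sys.A *ₑ x + P.sys.B *ₑ u + P.w t, π.A *ₑ s + π.B *ₑ y)

/-- `v_t^π = (y_t^π, u_t^π)`. -/
def ldcV (P : Instance dx ds dy du dη) (π : LDC dy du) (t : ℕ) : VecYU dy du :=
  let y := P.sys.C *ₑ (P.ldcState π t).1 + P.e t
  stack y (π.C *ₑ (P.ldcState π t).2 + π.D *ₑ y)

end Instance

/-! ### Markov operators -/

/-- The norm `‖G‖_{ℓ₁,op} = ∑ ‖G^[i]‖`; it is only used together with summability. -/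
def l1op {ι κ : Type} [Fintype ι] [Fintype κ] [DecidableEq κ] (G : ℕ → Matrix ι κ ℝ) : ℝ :=
  ∑' i, ‖G i‖

/-- The decay function `ψ_G(n) = ∑_{i ≥ n} ‖G^[i]‖`; it is only used together with summability. -/
def decay {ι κ : Type} [Fintype ι] [Fintype κ] [DecidableEq κ] (G : ℕ → Matrix ι κ ℝ) (n : ℕ) :
    ℝ :=
  ∑' i, ‖G (n + i)‖

/-- Proper, stable decay functions (finiteness of `ψ 0` is automatic for real values). -/
def IsDecayFunction (ψ : ℕ → ℝ) : Prop := (∀ n, 0 ≤ ψ n) ∧ Antitone ψ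

namespace Instance

/-- State matrix of the closed loop with the nominal controller, on `(x, s)`. -/
def Acl (P : Instance dx ds dy du dη) : Matrix (Fin dx ⊕ Fin ds) (Fin dx ⊕ Fin ds) ℝ :=
  Matrix.fromBlocks (P.sys.A + P.sys.B * P.ctrl.D * P.sys.C) (P.sys.B * P.ctrl.C)
    (P.ctrl.B * P.sys.C) P.ctrl.A

/-- Input matrix of the closed loop, from `uᵉˣ` to `(x, s)`. -/
def Bcl (P : Instance dx ds dy du dη) : Matrix (Fin dx ⊕ Fin ds) (Fin du) ℝ :=
  Matrix.fromRows P.sys.B P.ctrl.Bu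

/-- The Markov operator `G_{ex → v}` from exogenous inputs to `v = (y, u)`. -/
def Gv (P : Instance dx ds dy du dη) : ℕ → Matrix (Fin dy ⊕ Fin du) (Fin du) ℝ
  | 0 => Matrix.fromRows 0 1
  | i + 1 => Matrix.fromBlocks P.sys.C 0 (P.ctrl.D * P.sys.C) P.ctrl.C * P.Acl ^ i * P.Bcl

/-- The Markov operator `G_{ex → η}` from exogenous inputs to `η`. -/
def Gη (P : Instance dx ds dy du dη) : ℕ → Matrix (Fin dη) (Fin du) ℝ
  | 0 => 0
  | i + 1 => Matrix.fromCols (P.ctrl.Dη * P.sys.C) P.ctrl.Cη * P.Acl ^ i * P.Bcl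

/-- `Gc` is a conversion operator `π₀ → π`: with the inputs `∑_{j ≤ i} Gc^[i-j] η^nat_j`, the
nominal closed loop reproduces the sequence `(y^π, u^π)`. -/
def IsConversion (P : Instance dx ds dy du dη) (π : LDC dy du)
    (Gc : ℕ → Matrix (Fin du) (Fin dη) ℝ) : Prop :=
  ∀ t, P.ldcV π t = P.vNat t + ∑ i ∈ Finset.range (t + 1),
    P.Gv (t - i) *ₑ (∑ j ∈ Finset.range (i + 1), Gc (i - j) *ₑ P.ηNat j)

/-- The benchmark class `Π_{stab,π₀}(R, ψ)`. -/
def policyClass (P : Instance dx ds dy du dη) (R : ℝ) (ψ : ℕ → ℝ) : Set (LDC dy du) :=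
  {π | ∃ Gc : ℕ → Matrix (Fin du) (Fin dη) ℝ, P.IsConversion π Gc ∧
    Summable (fun i => ‖Gc i‖) ∧ l1op Gc ≤ R ∧ ∀ n, decay Gc n ≤ ψ n}

end Instance

/-! ### Disturbance response controllers -/

/-- The input `uᵉˣ_t(M | η) = ∑_{i < m} M^[i] η_{t-i}`, where `η` vanishes before the start. -/
def drcInput {m : ℕ} (M : Fin m → Matrix (Fin du) (Fin dη) ℝ) (η : ℕ → Vec dη) (t : ℕ) : Vec du :=
  ∑ i : Fin m, if (i : ℕ) ≤ t then M i *ₑ η (t - i) else 0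

/-- The controller class `M_drc(m, R)`. -/
def drcClass (du dη m : ℕ) (R : ℝ) : Set (Fin m → Matrix (Fin du) (Fin dη) ℝ) :=
  {M | ∑ i, ‖M i‖ ≤ R}

/-- The space of vectorized controller parameters. -/
abbrev ParamVec (m du dη : ℕ) : Type := EuclideanSpace ℝ (Fin m × Fin du × Fin dη)

/-- The vectorization `𝔢(M)` of a controller parameter. -/
def embed {m : ℕ} (M : Fin m → Matrix (Fin du) (Fin dη) ℝ) : ParamVec m du dη :=
  WithLp.toLp 2 (fun p => M p.1 p.2.1 p.2.2)

/-- The matrix `𝐘_t` built from `η`, for which `𝐘_t 𝔢(M) = uᵉˣ_t(M | η)`. -/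
def embedY (m du : ℕ) {dη : ℕ} (η : ℕ → Vec dη) (t : ℕ) :
    Matrix (Fin du) (Fin m × Fin du × Fin dη) ℝ :=
  fun a p => if a = p.2.1 ∧ (p.1 : ℕ) ≤ t then η (t - p.1) p.2.2 else 0

theorem embedY_act_embed {m : ℕ} (M : Fin m → Matrix (Fin du) (Fin dη) ℝ) (η : ℕ → Vec dη)
    (t : ℕ) : embedY m du η t *ₑ embed M = drcInput M η t := by
  ext a
  simp only [act, embed, embedY, drcInput, Matrix.mulVec, dotProduct, Fintype.sum_prod_type]
  rw [WithLp.ofLp_sum, Finset.sum_apply]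
  refine Finset.sum_congr rfl fun i _ => ?_
  by_cases hi : (i : ℕ) ≤ t
  · simp [hi, Matrix.mulVec, dotProduct, mul_comm]
  · simp [hi]

namespace Instance

/-- The algorithm's reconstruction `η̂^nat_t = η_t - ∑_{j < t} Ĝ^[t-j] uᵉˣ_j` of nature's `η`. -/
def ηHat (P : Instance dx ds dy du dη) (Ghat : ℕ → Matrix (Fin dη) (Fin du) ℝ)
    (uex : ℕ → Vec du) (t : ℕ) : Vec dη :=
  P.η uex t - ∑ j ∈ Finset.range t, Ghat (t - j) *ₑ uex j

/-- The first `k` exogenous inputs of the algorithm (continued by zero). During the `N`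
exploration rounds the input is `ξ t`; afterwards it is `uᵉˣ_t(M_t | η̂^nat)`, with `η̂^nat`
reconstructed from the signals and inputs seen so far and the estimate `Ghat`. -/
def algPrefix (P : Instance dx ds dy du dη) {m : ℕ} (N : ℕ) (ξ : ℕ → Vec du)
    (Ghat : ℕ → Matrix (Fin dη) (Fin du) ℝ) (M : ℕ → Fin m → Matrix (Fin du) (Fin dη) ℝ) :
    ℕ → ℕ → Vec du
  | 0 => 0
  | t + 1 => Function.update (algPrefix P N ξ Ghat M t) t
      (if t < N then ξ t else drcInput (M t) (P.ηHat Ghat (algPrefix P N ξ Ghat M t)) t)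

/-- The exogenous inputs of the estimate-then-control algorithm with exploration inputs `ξ`,
estimate `Ghat` of `G_{ex → η}` and controller iterates `M_t`. -/
def algInput (P : Instance dx ds dy du dη) {m : ℕ} (N : ℕ) (ξ : ℕ → Vec du)
    (Ghat : ℕ → Matrix (Fin dη) (Fin du) ℝ) (M : ℕ → Fin m → Matrix (Fin du) (Fin dη) ℝ)
    (t : ℕ) : Vec du :=
  P.algPrefix N ξ Ghat M (t + 1) t

/-! ### Regret -/

/-- `ControlReg_T` of exogenous inputs `uex` against a nonempty policy class. -/
def controlRegret (P : Instance dx ds dy du dη) (T : ℕ) (uex : ℕ → Vec du)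
    (Pi : Set (LDC dy du)) : ℝ :=
  ∑ t ∈ Finset.range T, P.loss t (P.v uex t)
    - sInf ((fun π => ∑ t ∈ Finset.range T, P.loss t (P.ldcV π t)) '' Pi)

/-- The loss with memory
`F_t(z_{t:t-h} | η) = ℓ_t(v^nat_t + ∑_{i ≤ h} G_{ex → v}^[i] 𝐘_{t-i} z_{t-i})`, where `𝐘_s` is
built from `η` (and vanishes before the start). -/
def memLoss (P : Instance dx ds dy du dη) {m : ℕ} (h : ℕ) (η : ℕ → Vec dη) (t : ℕ)
    (z : ℕ → ParamVec m du dη) : ℝ :=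
  P.loss t (P.vNat t + ∑ i ∈ Finset.range (h + 1),
    if i ≤ t then P.Gv i *ₑ (embedY m du η (t - i) *ₑ z (t - i)) else 0)

/-- Memory regret on the indices `a ≤ t < T` against the fixed parameter `zstar`:
`∑ F_t(z_{t:t-h} | η) - ∑ f_t(zstar | η)`, where `f_t(z | η) = F_t(z, …, z | η)`. -/
def memoryRegret (P : Instance dx ds dy du dη) {m : ℕ} (h a T : ℕ) (η : ℕ → Vec dη)
    (z : ℕ → ParamVec m du dη) (zstar : ParamVec m du dη) : ℝ :=
  ∑ t ∈ Finset.Ico a T, P.memLoss h η t z - ∑ t ∈ Finset.Ico a T, P.memLoss h η t (fun _ => zstar)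

end Instance

/-! ### Assumptions -/

/-- Convex, differentiable, nonnegative, `L`-subquadratic losses. -/
structure IsRegularLoss (L : ℝ) (ℓ : VecYU dy du → ℝ) : Prop where
  convex : ConvexOn ℝ Set.univ ℓ
  differentiable : Differentiable ℝ ℓ
  nonneg : ∀ v, 0 ≤ ℓ v
  le : ∀ v, ℓ v ≤ L * max 1 (‖v‖ ^ 2)
  grad_le : ∀ v, ‖gradient ℓ v‖ ≤ L * max 1 ‖v‖

/-- The Markov operator `G` is stable, with norm at most `R` and decay function at most `ψ`. -/
structure IsStableOperator {ι κ : Type} [Fintype ι] [Fintype κ] [DecidableEq κ]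
    (G : ℕ → Matrix ι κ ℝ) (R : ℝ) (ψ : ℕ → ℝ) : Prop where
  summable : Summable (fun i => ‖G i‖)
  norm_le : l1op G ≤ R
  decay_le : ∀ n, decay G n ≤ ψ n

/-- The parameters of the algorithm and of the assumptions. -/
structure Params where
  /-- horizon -/
  T : ℕ
  /-- number of exploration rounds -/
  N : ℕ
  /-- memory length -/
  h : ℕ
  /-- controller length of the algorithm -/
  m : ℕ
  /-- controller length of the comparator -/
  mstar : ℕ
  L : ℝ
  /-- bound on the Markov operators of the nominal closed loop -/
  R0 : ℝ
  /-- bound on nature's iterates -/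
  Rnat : ℝ
  /-- controller radius of the algorithm -/
  RM : ℝ
  /-- controller radius of the comparator -/
  Rstar : ℝ
  /-- slack -/
  c : ℝ
  /-- failure probability -/
  δ : ℝ
  /-- estimation error -/
  ε : ℝ
  ψ0 : ℕ → ℝ
  ψstar : ℕ → ℝ

/-- The bound `R_{u,est} = 3 √(d_u + log (1/δ))` on the exploration inputs. -/
def Params.Ruest (p : Params) (du : ℕ) : ℝ := 3 * √(du + Real.log (1 / p.δ))

/-- Relations among the parameters. -/
structure Params.Admissible (p : Params) : Prop where
  one_le_T : 1 ≤ p.T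
  one_le_m : 1 ≤ p.m
  one_le_Rnat : 1 ≤ p.Rnat
  one_le_RM : 1 ≤ p.RM
  one_le_c : 1 ≤ p.c
  δ_pos : 0 < p.δ
  δ_lt_one : p.δ < 1
  decay_ψ0 : IsDecayFunction p.ψ0
  decay_ψstar : IsDecayFunction p.ψstar
  two_Rstar_le_RM : 2 * p.Rstar ≤ p.RM
  m_ge : 2 * p.mstar + p.h ≤ p.m
  N_ge : p.m + p.h ≤ p.N
  ψ0_le : p.ψ0 (p.h + 1) ≤ p.c * p.R0 / p.T
  ψstar_le : p.ψstar p.mstar ≤ p.c * p.Rstar / p.T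

/-- Regular losses, a stable nominal closed loop, and bounded nature's iterates. -/
structure Instance.Regular (P : Instance dx ds dy du dη) (p : Params) : Prop where
  loss : ∀ t, IsRegularLoss p.L (P.loss t)
  Gv : IsStableOperator P.Gv p.R0 p.ψ0
  Gη : IsStableOperator P.Gη p.R0 p.ψ0
  vNat_le : ∀ t, ‖P.vNat t‖ ≤ p.Rnat
  ηNat_le : ∀ t, ‖P.ηNat t‖ ≤ p.Rnat

/-- `Ghat` is within `ε` of `G` in `ℓ₁,op`-norm. Beyond lag `h` it is truncated, as for an
estimate of the first `h` Markov parameters (or exact, which admits `Ghat = G`). -/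
structure IsMarkovEstimate {ι κ : Type} [Fintype ι] [Fintype κ] [DecidableEq κ] (h : ℕ) (ε : ℝ)
    (G Ghat : ℕ → Matrix ι κ ℝ) : Prop where
  tail : ∀ i, h < i → Ghat i = 0 ∨ Ghat i = G i
  summable : Summable (fun i => ‖Ghat i - G i‖)
  error_le : l1op (fun i => Ghat i - G i) ≤ ε

/-- The part of the estimation event that concerns the accuracy level and the exploration
inputs. -/
structure GoodExploration (p : Params) (ξ : ℕ → Vec du) : Prop where
  ε_le : p.ε ≤ 1 / max (p.Ruest du) (2 * p.RM * p.R0)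
  input_le : ∀ t < p.N, ‖ξ t‖ ≤ p.Ruest du

end NonstochasticControl

end

noncomputable section

namespace NonstochasticControl

open Finset

variable {dx ds dy du dη : ℕ}

/-! ### Linearity and norm bounds of the matrix action. -/

section Act

variable {ι κ l : Type} [Fintype ι] [Fintype κ] [Fintype l]

/-! Write `u` for the inputs played, `n` for nature's signal, `x` for its reconstruction and `D` for
the error of the estimate of `Gη` at positive lags. By superposition (`v_eq`, `η_eq`, `ηHat_eq`) the
outputs are `vNat` plus a convolution of the inputs, and `x = n - D u`. A benchmark policy with
conversion operator `Gc` uses the inputs `Gc n`, whereas a parameter of the algorithm can only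
filter `x`. Filtering `x` by `Gc` leaves an error `Gc D u`, which is of first order in `ε` and would
cost `T ε`.

Two devices bring the cost down to `T ε²`. The first is the comparator `w = (β G + β² G D G) x`,
where `G` is `Gc` cut off at lag `mstar`. Replacing `u` by `w + (u - w)` in `G D u` cancels the
first-order term, and up to truncation only `β G D (u - w)` and the second-order `β³ G D G D G x`
remain (`smul_conv_sub_conv_comparator`). By Young's inequality the squares of the former sum to at
most `(R0 RM ε)²` times the total squared distance of `u` to `w`; after the start-up rounds this
distance is exactly the curvature sum in the claim.

The second is the shrinkage `β = 1 - α`. By convexity, pulling the policy's response towards `vNat`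
by the fraction `α` absorbs a perturbation `d` at cost of order `L (α Rnat² + ‖d‖² / α)`, regardless
of how large the response is (`shrink_add_le`). Optimizing `α` gives the geometric mean of `Rnat² T`
and the total squared perturbation. The perturbation depends on `α` through `w`, so the optimal `α`
comes from the intermediate value theorem (`exists_balanced_weight`). This yields
`exists_comparator`, in which `ν` does not appear; `ν` enters only when the geometric mean is split
by AM-GM (`sqrt_mul_le_of_split`).

What remains is bookkeeping: inputs and reconstructions stay bounded, the start-up rounds cost their
number times a bound on the loss, and replacing true losses by losses with memory costs only the
tail of `Gv`. -/

theorem act_add (A : Matrix ι κ ℝ) (x y : EuclideanSpace ℝ κ) :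
    A *ₑ (x + y) = A *ₑ x + A *ₑ y := by
  simp [act, Matrix.mulVec_add]

theorem act_sub (A : Matrix ι κ ℝ) (x y : EuclideanSpace ℝ κ) :
    A *ₑ (x - y) = A *ₑ x - A *ₑ y := by
  simp [act, Matrix.mulVec_sub]

theorem act_smul (A : Matrix ι κ ℝ) (r : ℝ) (x : EuclideanSpace ℝ κ) :
    A *ₑ (r • x) = r • (A *ₑ x) := by
  simp [act, Matrix.mulVec_smul]

theorem act_zero (A : Matrix ι κ ℝ) : A *ₑ (0 : EuclideanSpace ℝ κ) = 0 := by
  simp [act]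

theorem zero_act (x : EuclideanSpace ℝ κ) : (0 : Matrix ι κ ℝ) *ₑ x = 0 := by
  simp [act]

theorem one_act [DecidableEq κ] (x : EuclideanSpace ℝ κ) : (1 : Matrix κ κ ℝ) *ₑ x = x := by
  simp [act]

theorem add_act (A B : Matrix ι κ ℝ) (x : EuclideanSpace ℝ κ) :
    (A + B) *ₑ x = A *ₑ x + B *ₑ x := by
  simp [act, Matrix.add_mulVec]

theorem sub_act (A B : Matrix ι κ ℝ) (x : EuclideanSpace ℝ κ) :
    (A - B) *ₑ x = A *ₑ x - B *ₑ x := by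
  simp [act, Matrix.sub_mulVec]

theorem smul_act (r : ℝ) (A : Matrix ι κ ℝ) (x : EuclideanSpace ℝ κ) :
    (r • A) *ₑ x = r • (A *ₑ x) := by
  simp [act, Matrix.smul_mulVec]

theorem mul_act (A : Matrix ι κ ℝ) (B : Matrix κ l ℝ) (x : EuclideanSpace ℝ l) :
    (A * B) *ₑ x = A *ₑ (B *ₑ x) := by
  simp [act, Matrix.mulVec_mulVec]

theorem act_sum {α : Type} (s : Finset α) (A : Matrix ι κ ℝ) (f : α → EuclideanSpace ℝ κ) :
    A *ₑ (∑ i ∈ s, f i) = ∑ i ∈ s, A *ₑ f i := by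
  classical
  induction s using Finset.induction_on with
  | empty => simp [act_zero]
  | insert a s ha ih => rw [sum_insert ha, sum_insert ha, act_add, ih]

theorem sum_act {α : Type} (s : Finset α) (f : α → Matrix ι κ ℝ) (x : EuclideanSpace ℝ κ) :
    (∑ i ∈ s, f i) *ₑ x = ∑ i ∈ s, f i *ₑ x := by
  classical
  induction s using Finset.induction_on with
  | empty => simp [zero_act]
  | insert a s ha ih => rw [sum_insert ha, sum_insert ha, add_act, ih]

theorem norm_act_le [DecidableEq κ] (A : Matrix ι κ ℝ) (x : EuclideanSpace ℝ κ) :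
    ‖A *ₑ x‖ ≤ ‖A‖ * ‖x‖ :=
  Matrix.l2_opNorm_mulVec A x

theorem norm_le_of_norm_act_le [DecidableEq κ] {A : Matrix ι κ ℝ} {c : ℝ} (hc : 0 ≤ c)
    (h : ∀ x, ‖A *ₑ x‖ ≤ c * ‖x‖) : ‖A‖ ≤ c := by
  rw [Matrix.l2_opNorm_def]
  exact ContinuousLinearMap.opNorm_le_bound _ hc h

end Act

/-! ### Convolutions -/

section Conv

variable {ι κ l : Type} [Fintype ι] [Fintype κ] [Fintype l]

/-- The response `∑_{i + j = t} G^[i] x_j` of a Markov operator to an input sequence. -/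
def conv (G : ℕ → Matrix ι κ ℝ) (x : ℕ → EuclideanSpace ℝ κ) (t : ℕ) : EuclideanSpace ℝ ι :=
  ∑ p ∈ antidiagonal t, G p.1 *ₑ x p.2

/-- The composition of two Markov operators. -/
def mconv (G : ℕ → Matrix ι κ ℝ) (H : ℕ → Matrix κ l ℝ) (t : ℕ) : Matrix ι l ℝ :=
  ∑ p ∈ antidiagonal t, G p.1 * H p.2

theorem conv_eq_sum_range (G : ℕ → Matrix ι κ ℝ) (x : ℕ → EuclideanSpace ℝ κ) (t : ℕ) :
    conv G x t = ∑ i ∈ range (t + 1), G i *ₑ x (t - i) :=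
  Nat.sum_antidiagonal_eq_sum_range_succ (fun i j => G i *ₑ x j) t

theorem conv_eq_sum_range' (G : ℕ → Matrix ι κ ℝ) (x : ℕ → EuclideanSpace ℝ κ) (t : ℕ) :
    conv G x t = ∑ j ∈ range (t + 1), G (t - j) *ₑ x j := by
  rw [conv, ← Nat.sum_antidiagonal_swap]
  exact Nat.sum_antidiagonal_eq_sum_range_succ (fun j i => G i *ₑ x j) t

theorem conv_add (G : ℕ → Matrix ι κ ℝ) (x y : ℕ → EuclideanSpace ℝ κ) :
    conv G (x + y) = conv G x + conv G y := by
  funext t; simp [conv, act_add, sum_add_distrib]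

theorem conv_sub (G : ℕ → Matrix ι κ ℝ) (x y : ℕ → EuclideanSpace ℝ κ) :
    conv G (x - y) = conv G x - conv G y := by
  funext t; simp [conv, act_sub, sum_sub_distrib]

theorem conv_smul (G : ℕ → Matrix ι κ ℝ) (r : ℝ) (x : ℕ → EuclideanSpace ℝ κ) :
    conv G (r • x) = r • conv G x := by
  funext t; simp [conv, act_smul, smul_sum]

theorem add_conv (G H : ℕ → Matrix ι κ ℝ) (x : ℕ → EuclideanSpace ℝ κ) :
    conv (G + H) x = conv G x + conv H x := by
  funext t; simp [conv, add_act, sum_add_distrib]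

theorem smul_conv (r : ℝ) (G : ℕ → Matrix ι κ ℝ) (x : ℕ → EuclideanSpace ℝ κ) :
    conv (r • G) x = r • conv G x := by
  funext t; simp [conv, smul_act, smul_sum]

theorem conv_conv (G : ℕ → Matrix ι κ ℝ) (H : ℕ → Matrix κ l ℝ) (x : ℕ → EuclideanSpace ℝ l) :
    conv G (conv H x) = conv (mconv G H) x := by
  funext t
  simp only [conv, mconv, act_sum, sum_act, mul_act, sum_sigma']
  refine sum_nbij' (fun p => ⟨(p.1.1 + p.2.1, p.2.2), (p.1.1, p.2.1)⟩)
    (fun p => ⟨(p.2.1, p.2.2 + p.1.2), (p.2.2, p.1.2)⟩) ?_ ?_ ?_ ?_ ?_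
  · rintro ⟨⟨a, b⟩, ⟨c, d⟩⟩ h
    simp only [mem_sigma, HasAntidiagonal.mem_antidiagonal] at h ⊢
    obtain ⟨rfl, rfl⟩ := h
    exact ⟨by ring, trivial⟩
  · rintro ⟨⟨a, b⟩, ⟨c, d⟩⟩ h
    simp only [mem_sigma, HasAntidiagonal.mem_antidiagonal] at h ⊢
    obtain ⟨rfl, rfl⟩ := h
    exact ⟨by ring, trivial⟩
  · rintro ⟨⟨a, b⟩, ⟨c, d⟩⟩ h
    simp only [mem_sigma, HasAntidiagonal.mem_antidiagonal] at h
    obtain ⟨_, rfl⟩ := h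
    rfl
  · rintro ⟨⟨a, b⟩, ⟨c, d⟩⟩ h
    simp only [mem_sigma, HasAntidiagonal.mem_antidiagonal] at h
    obtain ⟨_, rfl⟩ := h
    rfl
  · rintro ⟨⟨a, b⟩, ⟨c, d⟩⟩ h
    rfl

/-- The largest lags present are `a - 1` and `b - 1`, so the composition ends at lag `a + b - 2`. -/
theorem mconv_eq_zero {G : ℕ → Matrix ι κ ℝ} {H : ℕ → Matrix κ l ℝ} {a b n : ℕ}
    (hG : ∀ i, a ≤ i → G i = 0) (hH : ∀ i, b ≤ i → H i = 0) (hn : a + b ≤ n + 1) :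
    mconv G H n = 0 := by
  refine sum_eq_zero fun p hp => ?_
  rw [HasAntidiagonal.mem_antidiagonal] at hp
  rcases le_or_gt a p.1 with h | h
  · rw [hG _ h, Matrix.zero_mul]
  · rw [hH p.2 (by omega), Matrix.mul_zero]

/-- The left side sums over the triangle `i + j < T`, the right side over the square containing it.
-/
theorem sum_range_sum_antidiagonal_le {a b : ℕ → ℝ} (ha : ∀ i, 0 ≤ a i) (hb : ∀ i, 0 ≤ b i)
    (T : ℕ) : ∑ t ∈ range T, ∑ p ∈ antidiagonal t, a p.1 * b p.2 ≤
      (∑ i ∈ range T, a i) * ∑ j ∈ range T, b j := by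
  have : ∑ t ∈ range T, ∑ p ∈ antidiagonal t, a p.1 * b p.2 =
      ∑ p ∈ range T ×ˢ range T with p.1 + p.2 < T, a p.1 * b p.2 := by
    rw [sum_sigma']
    refine sum_nbij' (fun q => q.2) (fun p => ⟨p.1 + p.2, p⟩) ?_ ?_ ?_ ?_ ?_
    · rintro ⟨t, p⟩ h
      simp only [mem_sigma, HasAntidiagonal.mem_antidiagonal, mem_range, mem_filter,
        mem_product] at h ⊢
      omega
    · rintro p h
      simp only [mem_sigma, HasAntidiagonal.mem_antidiagonal, mem_range, mem_filter] at h ⊢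
      exact ⟨h.2, trivial⟩
    · rintro ⟨t, p⟩ h
      simp only [mem_sigma, HasAntidiagonal.mem_antidiagonal] at h
      obtain ⟨_, rfl⟩ := h
      rfl
    · intro p _; rfl
    · intro p _; rfl
  rw [this, sum_mul_sum, ← sum_product']
  exact sum_le_sum_of_subset_of_nonneg (filter_subset _ _)
    fun p _ _ => mul_nonneg (ha _) (hb _)

/-- All partial sums of `‖G^[i]‖` are at most `g`. -/
def MassLe [DecidableEq κ] (G : ℕ → Matrix ι κ ℝ) (g : ℝ) : Prop := ∀ T, ∑ i ∈ range T, ‖G i‖ ≤ g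

variable [DecidableEq κ] [DecidableEq l]

theorem MassLe.nonneg {G : ℕ → Matrix ι κ ℝ} {g : ℝ} (h : MassLe G g) : 0 ≤ g := by
  simpa using h 0

theorem MassLe.mono {G H : ℕ → Matrix ι κ ℝ} {g : ℝ} (h : MassLe G g)
    (hH : ∀ i, ‖H i‖ ≤ ‖G i‖) : MassLe H g :=
  fun T => (sum_le_sum fun i _ => hH i).trans (h T)

theorem MassLe.of_tsum {G : ℕ → Matrix ι κ ℝ} {g : ℝ} (hs : Summable fun i => ‖G i‖)
    (h : l1op G ≤ g) : MassLe G g :=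
  fun _ => (hs.sum_le_tsum _ fun _ _ => norm_nonneg _).trans h

theorem MassLe.add {G H : ℕ → Matrix ι κ ℝ} {g g' : ℝ} (h : MassLe G g) (h' : MassLe H g') :
    MassLe (G + H) (g + g') := fun T => by
  refine le_trans (sum_le_sum fun _ _ => norm_add_le _ _) ?_
  rw [sum_add_distrib]
  exact add_le_add (h T) (h' T)

theorem MassLe.smul {G : ℕ → Matrix ι κ ℝ} {g : ℝ} (h : MassLe G g) {r : ℝ} (hr : 0 ≤ r) :
    MassLe (r • G) (r * g) := fun T => by
  simp only [Pi.smul_apply, norm_smul, ← mul_sum, Real.norm_of_nonneg hr]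
  exact mul_le_mul_of_nonneg_left (h T) hr

theorem MassLe.mconv {G : ℕ → Matrix ι κ ℝ} {H : ℕ → Matrix κ l ℝ} {g g' : ℝ} (h : MassLe G g)
    (h' : MassLe H g') : MassLe (mconv G H) (g * g') := fun T => by
  calc ∑ t ∈ range T, ‖NonstochasticControl.mconv G H t‖
      ≤ ∑ t ∈ range T, ∑ p ∈ antidiagonal t, ‖G p.1‖ * ‖H p.2‖ :=
        sum_le_sum fun t _ => (norm_sum_le _ _).trans
          (sum_le_sum fun p _ => Matrix.l2_opNorm_mul _ _)
    _ ≤ _ := sum_range_sum_antidiagonal_le (fun _ => norm_nonneg _) (fun _ => norm_nonneg _) T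
    _ ≤ _ := mul_le_mul (h T) (h' T) (sum_nonneg fun _ _ => norm_nonneg _) h.nonneg

/-- Markov parameters of lag at least `n`. -/
def tailFrom (n : ℕ) (G : ℕ → Matrix ι κ ℝ) (i : ℕ) : Matrix ι κ ℝ := if i < n then 0 else G i

/-- Markov parameters of lag less than `n`. -/
def trunc (n : ℕ) (G : ℕ → Matrix ι κ ℝ) (i : ℕ) : Matrix ι κ ℝ := if i < n then G i else 0

theorem trunc_add_tailFrom (n : ℕ) (G : ℕ → Matrix ι κ ℝ) : trunc n G + tailFrom n G = G := by
  funext i; by_cases h : i < n <;> simp [trunc, tailFrom, h]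

theorem MassLe.trunc {G : ℕ → Matrix ι κ ℝ} {g : ℝ} (h : MassLe G g) (n : ℕ) :
    MassLe (trunc n G) g := by
  refine h.mono fun i => ?_
  by_cases hi : i < n <;> simp [NonstochasticControl.trunc, hi]

theorem massLe_tailFrom {G : ℕ → Matrix ι κ ℝ} {g : ℝ} {n : ℕ} (hs : Summable fun i => ‖G i‖)
    (h : decay G n ≤ g) : MassLe (tailFrom n G) g := fun T => by
  have hs' : Summable fun i => ‖G (n + i)‖ := by
    simpa only [add_comm] using (summable_nat_add_iff n).2 hs
  refine le_trans ?_ ((hs'.sum_le_tsum (range T) fun i _ => norm_nonneg _).trans h)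
  calc ∑ i ∈ range T, ‖tailFrom n G i‖ ≤ ∑ i ∈ range (n + T), ‖tailFrom n G i‖ :=
        sum_le_sum_of_subset_of_nonneg (range_mono (by omega)) fun _ _ _ => norm_nonneg _
    _ = ∑ i ∈ range T, ‖G (n + i)‖ := by
        rw [sum_range_add, sum_eq_zero, zero_add]
        · simp [tailFrom]
        · intro i hi; simp [tailFrom, mem_range.1 hi]

/-- The alternative in `hx` serves strictly causal operators: the input at time `t` itself need not
be bounded yet, which is what an induction over time requires. -/
theorem norm_conv_le {G : ℕ → Matrix ι κ ℝ} {g B : ℝ} (hG : MassLe G g)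
    {x : ℕ → EuclideanSpace ℝ κ} (hB : 0 ≤ B) {t : ℕ}
    (hx : ∀ j ≤ t, G (t - j) = 0 ∨ ‖x j‖ ≤ B) : ‖conv G x t‖ ≤ g * B := by
  rw [conv_eq_sum_range]
  calc ‖∑ i ∈ range (t + 1), G i *ₑ x (t - i)‖ ≤ ∑ i ∈ range (t + 1), ‖G i‖ * B := by
        refine (norm_sum_le _ _).trans (sum_le_sum fun i hi => ?_)
        have hi := mem_range.1 hi
        rcases hx (t - i) (by omega) with h | h
        · rw [show t - (t - i) = i by omega] at h
          simp [h, zero_act]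
        · exact (norm_act_le _ _).trans (mul_le_mul_of_nonneg_left h (norm_nonneg _))
    _ ≤ g * B := by
        rw [← sum_mul]; exact mul_le_mul_of_nonneg_right (hG _) hB

theorem norm_conv_le' {G : ℕ → Matrix ι κ ℝ} {g B : ℝ} (hG : MassLe G g)
    {x : ℕ → EuclideanSpace ℝ κ} (hx : ∀ j, ‖x j‖ ≤ B) (t : ℕ) : ‖conv G x t‖ ≤ g * B :=
  norm_conv_le hG ((norm_nonneg _).trans (hx 0)) fun j _ => Or.inr (hx j)

/-- Cauchy–Schwarz with weights `‖G i‖`, whose total is at most `g`. -/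
theorem norm_conv_sq_le {G : ℕ → Matrix ι κ ℝ} {g : ℝ} (hG : MassLe G g)
    (x : ℕ → EuclideanSpace ℝ κ) (t : ℕ) :
    ‖conv G x t‖ ^ 2 ≤ g * ∑ p ∈ antidiagonal t, ‖G p.1‖ * ‖x p.2‖ ^ 2 := by
  have h1 : ‖conv G x t‖ ≤ ∑ p ∈ antidiagonal t, ‖G p.1‖ * ‖x p.2‖ :=
    (norm_sum_le _ _).trans (sum_le_sum fun p _ => norm_act_le _ _)
  have h2 : (∑ p ∈ antidiagonal t, ‖G p.1‖ * ‖x p.2‖) ^ 2 ≤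
      (∑ p ∈ antidiagonal t, ‖G p.1‖) * ∑ p ∈ antidiagonal t, ‖G p.1‖ * ‖x p.2‖ ^ 2 := by
    apply sum_sq_le_sum_mul_sum_of_sq_le_mul
    · exact fun _ _ => norm_nonneg _
    · exact fun _ _ => mul_nonneg (norm_nonneg _) (sq_nonneg _)
    · exact fun _ _ => le_of_eq (by ring)
  have h3 : ∑ p ∈ antidiagonal t, ‖G p.1‖ ≤ g := by
    have := Nat.sum_antidiagonal_eq_sum_range_succ (fun i _ => ‖G i‖) t
    exact this.trans_le (hG _)
  exact (pow_le_pow_left₀ (norm_nonneg _) h1 2).trans (h2.trans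
    (mul_le_mul_of_nonneg_right h3
      (sum_nonneg fun _ _ => mul_nonneg (norm_nonneg _) (sq_nonneg _))))

/-- Young's inequality for an `ℓ₁` kernel and an `ℓ₂` input: the weighted Cauchy–Schwarz bound gives
one factor `g`, summation over time the other. -/
theorem sum_norm_conv_sq_le {G : ℕ → Matrix ι κ ℝ} {g : ℝ} (hG : MassLe G g)
    (x : ℕ → EuclideanSpace ℝ κ) (T : ℕ) :
    ∑ t ∈ range T, ‖conv G x t‖ ^ 2 ≤ g ^ 2 * ∑ t ∈ range T, ‖x t‖ ^ 2 := by
  have h1 := sum_range_sum_antidiagonal_le (a := fun i => ‖G i‖) (b := fun j => ‖x j‖ ^ 2)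
    (fun i => norm_nonneg (G i)) (fun j => sq_nonneg ‖x j‖) T
  have h2 : 0 ≤ ∑ j ∈ range T, ‖x j‖ ^ 2 := sum_nonneg fun j _ => sq_nonneg ‖x j‖
  have h3 := sum_le_sum fun t (_ : t ∈ range T) => norm_conv_sq_le hG x t
  rw [← mul_sum] at h3
  have h4 := mul_le_mul_of_nonneg_left
    (h1.trans (mul_le_mul_of_nonneg_right (hG T) h2)) hG.nonneg
  rw [sq, mul_assoc]
  exact h3.trans h4

end Conv

/-! ### Block matrices and concatenated vectors. -/

theorem norm_toRows₁_le {ι₁ ι₂ κ : Type} [Fintype ι₁] [Fintype ι₂] [Fintype κ] [DecidableEq κ]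
    (A : Matrix (ι₁ ⊕ ι₂) κ ℝ) : ‖A.toRows₁‖ ≤ ‖A‖ := by
  refine norm_le_of_norm_act_le (norm_nonneg _) fun x => le_trans ?_ (norm_act_le A x)
  rw [EuclideanSpace.norm_eq, EuclideanSpace.norm_eq]
  refine Real.sqrt_le_sqrt ?_
  rw [Fintype.sum_sum_type]
  exact le_add_of_nonneg_right (sum_nonneg fun _ _ => sq_nonneg _)

/-- Concatenation of vectors. -/
def joinVec {ι₁ ι₂ : Type} (x : EuclideanSpace ℝ ι₁) (s : EuclideanSpace ℝ ι₂) :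
    EuclideanSpace ℝ (ι₁ ⊕ ι₂) :=
  WithLp.toLp 2 (Sum.elim x.ofLp s.ofLp)

theorem fromBlocks_act_joinVec {ι₁ ι₂ κ₁ κ₂ : Type} [Fintype ι₁] [Fintype ι₂] [Fintype κ₁]
    [Fintype κ₂] (A : Matrix ι₁ κ₁ ℝ) (B : Matrix ι₁ κ₂ ℝ) (C : Matrix ι₂ κ₁ ℝ)
    (D : Matrix ι₂ κ₂ ℝ) (x : EuclideanSpace ℝ κ₁) (s : EuclideanSpace ℝ κ₂) :
    Matrix.fromBlocks A B C D *ₑ joinVec x s =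
      joinVec (A *ₑ x + B *ₑ s) (C *ₑ x + D *ₑ s) := by
  simp [act, joinVec, Matrix.fromBlocks_mulVec]

theorem fromCols_act_joinVec {ι κ₁ κ₂ : Type} [Fintype ι] [Fintype κ₁]
    [Fintype κ₂] (A : Matrix ι κ₁ ℝ) (B : Matrix ι κ₂ ℝ)
    (x : EuclideanSpace ℝ κ₁) (s : EuclideanSpace ℝ κ₂) :
    Matrix.fromCols A B *ₑ joinVec x s = A *ₑ x + B *ₑ s := by
  simp [act, joinVec, Matrix.fromCols_mulVec]

theorem fromRows_act {ι₁ ι₂ κ : Type} [Fintype ι₁] [Fintype ι₂] [Fintype κ]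
    (A : Matrix ι₁ κ ℝ) (B : Matrix ι₂ κ ℝ) (x : EuclideanSpace ℝ κ) :
    Matrix.fromRows A B *ₑ x = joinVec (A *ₑ x) (B *ₑ x) := by
  simp [act, joinVec, Matrix.fromRows_mulVec]

theorem joinVec_add {ι₁ ι₂ : Type} (x x' : EuclideanSpace ℝ ι₁) (s s' : EuclideanSpace ℝ ι₂) :
    joinVec x s + joinVec x' s' = joinVec (x + x') (s + s') := by
  ext i; cases i <;> simp [joinVec]

theorem joinVec_sub {ι₁ ι₂ : Type} (x x' : EuclideanSpace ℝ ι₁) (s s' : EuclideanSpace ℝ ι₂) :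
    joinVec x s - joinVec x' s' = joinVec (x - x') (s - s') := by
  ext i; cases i <;> simp [joinVec]

/-! ### Superposition in the closed loop and causality of the algorithm. -/

namespace Instance

theorem state_congr (P : Instance dx ds dy du dη) {u u' : ℕ → Vec du} :
    ∀ {t : ℕ}, (∀ j < t, u j = u' j) → P.state u t = P.state u' t
  | 0, _ => rfl
  | t + 1, h => by
    simp only [state, state_congr P (fun j hj => h j (Nat.lt_succ_of_lt hj)),
      h t (Nat.lt_succ_self t)]

theorem ηHat_congr (P : Instance dx ds dy du dη) (Ghat : ℕ → Matrix (Fin dη) (Fin du) ℝ)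
    {u u' : ℕ → Vec du} {t : ℕ} (h : ∀ j < t, u j = u' j) :
    P.ηHat Ghat u t = P.ηHat Ghat u' t := by
  have h1 : ∑ j ∈ range t, Ghat (t - j) *ₑ u j = ∑ j ∈ range t, Ghat (t - j) *ₑ u' j :=
    sum_congr rfl fun j hj => by rw [h j (mem_range.1 hj)]
  simp only [ηHat, η, y, P.state_congr h, h1]

/-- The closed-loop state as one vector. -/
def clState (P : Instance dx ds dy du dη) (uex : ℕ → Vec du) (t : ℕ) :
    EuclideanSpace ℝ (Fin dx ⊕ Fin ds) :=
  joinVec (P.state uex t).1 (P.state uex t).2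

/-- The disturbances cancel in the difference of two trajectories, leaving a linear recursion driven
by the exogenous input alone. -/
theorem clState_succ_sub (P : Instance dx ds dy du dη) (uex : ℕ → Vec du) (t : ℕ) :
    P.clState uex (t + 1) - P.clState 0 (t + 1) =
      P.Acl *ₑ (P.clState uex t - P.clState 0 t) + P.Bcl *ₑ uex t := by
  simp only [clState, joinVec_sub, Acl, Bcl, fromBlocks_act_joinVec, fromRows_act, joinVec_add]
  congr 1
  · simp only [state, act_add, act_sub, add_act, mul_act, Pi.zero_apply, act_zero]
    abel
  · simp only [state, act_add, act_sub, mul_act, Pi.zero_apply, act_zero]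
    abel

theorem clState_sub (P : Instance dx ds dy du dη) (uex : ℕ → Vec du) (t : ℕ) :
    P.clState uex t - P.clState 0 t =
      ∑ j ∈ range t, (P.Acl ^ (t - 1 - j) * P.Bcl) *ₑ uex j := by
  induction t with
  | zero => simp [clState, state]
  | succ t ih =>
    rw [clState_succ_sub, ih, sum_range_succ, act_sum]
    congr 1
    · refine sum_congr rfl fun j hj => ?_
      rw [← mul_act, ← Matrix.mul_assoc, ← pow_succ']
      have := mem_range.1 hj
      rw [show t - 1 - j + 1 = t + 1 - 1 - j by omega]
    · simp

theorem η_eq (P : Instance dx ds dy du dη) (uex : ℕ → Vec du) :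
    P.η uex = P.ηNat + conv P.Gη uex := by
  funext t
  have h : P.η uex t - P.ηNat t = Matrix.fromCols (P.ctrl.Dη * P.sys.C) P.ctrl.Cη *ₑ
      (P.clState uex t - P.clState 0 t) := by
    simp only [clState, joinVec_sub, fromCols_act_joinVec, ηNat, η, y, mul_act, act_add, act_sub]
    abel
  rw [Pi.add_apply, ← sub_eq_iff_eq_add', h, clState_sub, act_sum, conv_eq_sum_range',
    sum_range_succ]
  simp only [Nat.sub_self, Gη, zero_act, add_zero]
  refine sum_congr rfl fun j hj => ?_
  have := mem_range.1 hj
  have hG : ∀ i, P.Gη (i + 1) = Matrix.fromCols (P.ctrl.Dη * P.sys.C) P.ctrl.Cη *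
      (P.Acl ^ i * P.Bcl) := fun i => Matrix.mul_assoc _ _ _
  rw [← mul_act, ← hG, show t - 1 - j + 1 = t - j by omega]
  rfl

theorem v_eq (P : Instance dx ds dy du dη) (uex : ℕ → Vec du) :
    P.v uex = P.vNat + conv P.Gv uex := by
  funext t
  have hv : ∀ u, P.v u t = joinVec (P.y u t) (P.u u t) := fun _ => rfl
  have h : P.v uex t - P.vNat t =
      Matrix.fromBlocks P.sys.C 0 (P.ctrl.D * P.sys.C) P.ctrl.C *ₑ
      (P.clState uex t - P.clState 0 t) + Matrix.fromRows 0 1 *ₑ uex t := by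
    simp only [vNat, hv, clState, joinVec_sub, fromBlocks_act_joinVec, fromRows_act, joinVec_add,
      zero_act, one_act]
    congr 1
    · simp only [y, act_sub]
      abel
    · simp only [u, y, mul_act, act_add, act_sub, Pi.zero_apply]
      abel
  rw [Pi.add_apply, ← sub_eq_iff_eq_add', h, clState_sub, act_sum, conv_eq_sum_range',
    sum_range_succ]
  simp only [Nat.sub_self, Gv]
  congr 1
  refine sum_congr rfl fun j hj => ?_
  have := mem_range.1 hj
  have hG : ∀ i, P.Gv (i + 1) = Matrix.fromBlocks P.sys.C 0 (P.ctrl.D * P.sys.C) P.ctrl.C *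
      (P.Acl ^ i * P.Bcl) := fun i => Matrix.mul_assoc _ _ _
  rw [← mul_act, ← hG, show t - 1 - j + 1 = t - j by omega]
  rfl

/-- The reconstruction errs by the estimation error applied to past inputs. Lag `0` drops out
because `Gη 0 = 0` and the reconstruction never uses `Ghat 0`. -/
theorem ηHat_eq (P : Instance dx ds dy du dη) (Ghat : ℕ → Matrix (Fin dη) (Fin du) ℝ)
    (uex : ℕ → Vec du) :
    P.ηHat Ghat uex = P.ηNat - conv (tailFrom 1 (Ghat - P.Gη)) uex := by
  funext t
  simp only [ηHat, η_eq, Pi.add_apply, Pi.sub_apply, conv_eq_sum_range']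
  rw [sum_range_succ, sum_range_succ]
  have h1 : ∑ j ∈ range t, tailFrom 1 (Ghat - P.Gη) (t - j) *ₑ uex j =
      ∑ j ∈ range t, Ghat (t - j) *ₑ uex j - ∑ j ∈ range t, P.Gη (t - j) *ₑ uex j := by
    rw [← sum_sub_distrib]
    refine sum_congr rfl fun j hj => ?_
    have := mem_range.1 hj
    rw [tailFrom, if_neg (by omega), Pi.sub_apply, sub_act]
  rw [h1]
  simp only [Nat.sub_self, Gη, tailFrom, Nat.lt_one_iff, if_true, zero_act]
  abel

variable {m : ℕ}

theorem algPrefix_eq_algInput (P : Instance dx ds dy du dη) (N : ℕ) (ξ : ℕ → Vec du)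
    (Ghat : ℕ → Matrix (Fin dη) (Fin du) ℝ) (M : ℕ → Fin m → Matrix (Fin du) (Fin dη) ℝ)
    {k j : ℕ} (h : j < k) : P.algPrefix N ξ Ghat M k j = P.algInput N ξ Ghat M j := by
  induction k with
  | zero => omega
  | succ k ih =>
    rcases Nat.lt_succ_iff_lt_or_eq.1 h with h' | rfl
    · rw [algPrefix, Function.update_of_ne h'.ne, ih h']
    · rfl

theorem algInput_of_lt (P : Instance dx ds dy du dη) {N : ℕ} (ξ : ℕ → Vec du)
    (Ghat : ℕ → Matrix (Fin dη) (Fin du) ℝ) (M : ℕ → Fin m → Matrix (Fin du) (Fin dη) ℝ)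
    {t : ℕ} (h : t < N) : P.algInput N ξ Ghat M t = ξ t := by
  simp [algInput, algPrefix, h]

/-- The reconstruction at time `t` sees only inputs before `t`, so the finite prefix in the
recursion may be replaced by the entire input sequence. -/
theorem algInput_of_le (P : Instance dx ds dy du dη) {N : ℕ} (ξ : ℕ → Vec du)
    (Ghat : ℕ → Matrix (Fin dη) (Fin du) ℝ) (M : ℕ → Fin m → Matrix (Fin du) (Fin dη) ℝ)
    {t : ℕ} (h : N ≤ t) : P.algInput N ξ Ghat M t =
      drcInput (M t) (P.ηHat Ghat (P.algInput N ξ Ghat M)) t := by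
  have h1 : P.algInput N ξ Ghat M t =
      drcInput (M t) (P.ηHat Ghat (P.algPrefix N ξ Ghat M t)) t := by
    simp [algInput, algPrefix, h.not_gt]
  rw [h1]
  refine sum_congr rfl fun i _ => ?_
  rw [P.ηHat_congr Ghat fun j hj =>
    P.algPrefix_eq_algInput N ξ Ghat M (lt_of_lt_of_le hj (Nat.sub_le t i))]

theorem ldcV_eq (P : Instance dx ds dy du dη) {π : LDC dy du}
    {Gc : ℕ → Matrix (Fin du) (Fin dη) ℝ} (h : P.IsConversion π Gc) :
    P.ldcV π = P.vNat + conv P.Gv (conv Gc P.ηNat) := by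
  funext t
  simp only [h t, Pi.add_apply, conv_eq_sum_range']

end Instance

/-! ### Disturbance response inputs and losses with memory as convolutions. -/

theorem drcInput_eq_conv {m : ℕ} {H : ℕ → Matrix (Fin du) (Fin dη) ℝ} (hH : ∀ i, m ≤ i → H i = 0)
    (η : ℕ → Vec dη) (t : ℕ) : drcInput (fun i : Fin m => H i) η t = conv H η t := by
  rw [conv_eq_sum_range, drcInput,
    Fin.sum_univ_eq_sum_range (fun i => if i ≤ t then H i *ₑ η (t - i) else 0) m]
  have h1 : ∀ k, t + 1 ≤ k → m ≤ k →
      ∑ i ∈ range k, (if i ≤ t then H i *ₑ η (t - i) else 0) =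
        ∑ i ∈ range m, if i ≤ t then H i *ₑ η (t - i) else 0 := by
    intro k _ hk
    refine (sum_subset (range_mono hk) fun i _ hi => ?_).symm
    rw [hH i (by simpa using hi), zero_act, ite_self]
  have h2 : ∀ k, t + 1 ≤ k → m ≤ k →
      ∑ i ∈ range k, (if i ≤ t then H i *ₑ η (t - i) else 0) =
        ∑ i ∈ range (t + 1), H i *ₑ η (t - i) := by
    intro k hk _
    rw [← sum_subset (range_mono hk) fun i _ hi => ?_]
    · exact sum_congr rfl fun i hi => if_pos (Nat.lt_succ_iff.1 (mem_range.1 hi))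
    · exact if_neg (by simpa using hi)
  -- Both sums extend to a common range: terms beyond `m` vanish by `hH`, terms beyond `t` by the
  -- case distinction.
  rw [← h1 (max (t + 1) m) (le_max_left _ _) (le_max_right _ _),
    h2 _ (le_max_left _ _) (le_max_right _ _)]

theorem norm_drcInput_le {m : ℕ} {M : Fin m → Matrix (Fin du) (Fin dη) ℝ} {R B : ℝ}
    (hM : M ∈ drcClass du dη m R) {η : ℕ → Vec dη} {t : ℕ} (hη : ∀ s ≤ t, ‖η s‖ ≤ B) :
    ‖drcInput M η t‖ ≤ R * B := by
  have hB : 0 ≤ B := (norm_nonneg _).trans (hη t le_rfl)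
  calc ‖drcInput M η t‖ ≤ ∑ i, ‖M i‖ * B := by
        refine (norm_sum_le _ _).trans (sum_le_sum fun i _ => ?_)
        split_ifs with h
        · exact (norm_act_le _ _).trans
            (mul_le_mul_of_nonneg_left (hη _ (Nat.sub_le _ _)) (norm_nonneg _))
        · rw [norm_zero]; positivity
    _ ≤ R * B := by rw [← sum_mul]; exact mul_le_mul_of_nonneg_right hM hB

theorem Instance.memLoss_embed (P : Instance dx ds dy du dη) {m : ℕ} (h : ℕ) (η : ℕ → Vec dη)
    (t : ℕ) (M : ℕ → Fin m → Matrix (Fin du) (Fin dη) ℝ) :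
    P.memLoss h η t (fun s => embed (M s)) =
      P.loss t (P.vNat t + conv (trunc (h + 1) P.Gv) (fun s => drcInput (M s) η s) t) := by
  have hz : ∀ i, h + 1 ≤ i → trunc (h + 1) P.Gv i = 0 := fun i hi => if_neg (by omega)
  simp only [memLoss, embedY_act_embed]
  congr 2
  rw [conv_eq_sum_range]
  have h1 : ∑ i ∈ range (h + 1), (if i ≤ t then P.Gv i *ₑ drcInput (M (t - i)) η (t - i) else 0)
      = ∑ i ∈ range (h + 1) with i ≤ t, P.Gv i *ₑ drcInput (M (t - i)) η (t - i) :=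
    (sum_filter _ _).symm
  have h2 : ∑ i ∈ range (t + 1), trunc (h + 1) P.Gv i *ₑ drcInput (M (t - i)) η (t - i)
      = ∑ i ∈ range (t + 1) with i < h + 1, P.Gv i *ₑ drcInput (M (t - i)) η (t - i) := by
    rw [sum_filter]
    refine sum_congr rfl fun i _ => ?_
    by_cases hi : i < h + 1 <;> simp [trunc, hi, zero_act]
  rw [h1, h2]
  refine sum_congr ?_ fun _ _ => rfl
  ext i
  simp only [mem_filter, mem_range]
  omega

/-! ### Static feedback. -/

theorem Gη_static (P : Instance dx 0 dy du dy) {K : Matrix (Fin du) (Fin dy) ℝ}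
    (hP : P.ctrl = NominalController.static K) (i : ℕ) : P.Gη i = (P.Gv i).toRows₁ := by
  cases i with
  | zero => ext a b; simp [Instance.Gη, Instance.Gv]
  | succ i =>
    have h1 : Matrix.fromCols (P.ctrl.Dη * P.sys.C) P.ctrl.Cη =
        (Matrix.fromBlocks P.sys.C 0 (P.ctrl.D * P.sys.C) P.ctrl.C).toRows₁ := by
      rw [hP]
      ext a b
      rcases b with b | b
      · simp [NominalController.static, Matrix.toRows₁]
      · exact b.elim0
    rw [Instance.Gη, h1]
    rfl

theorem isMarkovEstimate_toRows₁ {h : ℕ} {ε : ℝ} {G Ghat : ℕ → Matrix (Fin dy ⊕ Fin du) (Fin du) ℝ}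
    (H : IsMarkovEstimate h ε G Ghat) :
    IsMarkovEstimate h ε (fun i => (G i).toRows₁) (fun i => (Ghat i).toRows₁) where
  tail i hi := (H.tail i hi).imp (fun e => by rw [e]; rfl) (fun e => by rw [e])
  summable := H.summable.of_nonneg_of_le (fun _ => norm_nonneg _)
    fun i => norm_toRows₁_le (Ghat i - G i)
  error_le := le_trans (Summable.tsum_le_tsum (fun i => norm_toRows₁_le (Ghat i - G i))
    (H.summable.of_nonneg_of_le (fun _ => norm_nonneg _) fun i => norm_toRows₁_le (Ghat i - G i))
    H.summable) H.error_le

/-! ### Scalar estimates -/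

/-- The weight should balance `α S` against `Q α / α`, but `Q` itself moves with `α`, so a fixed
point is found by continuity. Positivity of `Q 0` excludes `α = 0`; if no crossing is forced, `α =
1` is the fallback. -/
theorem exists_balanced_weight {Q : ℝ → ℝ} (hQ : Continuous Q) (hpos : ∀ α, 0 < Q α) {S : ℝ} :
    ∃ α : ℝ, 0 < α ∧ α ≤ 1 ∧ (α ^ 2 * S = Q α ∨ (α = 1 ∧ S ≤ Q 1)) := by
  rcases le_total S (Q 1) with h | h
  · exact ⟨1, one_pos, le_rfl, Or.inr ⟨rfl, h⟩⟩
  · have hc : ContinuousOn (fun α : ℝ => α ^ 2 * S - Q α) (Set.Icc 0 1) :=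
      (by fun_prop : Continuous fun α : ℝ => α ^ 2 * S - Q α).continuousOn
    obtain ⟨α, hα, h0⟩ := intermediate_value_Icc zero_le_one hc
      (show (0 : ℝ) ∈ Set.Icc _ _ from ⟨by have := hpos 0; simpa using this.le, by simpa using h⟩)
    have h0 : α ^ 2 * S = Q α := sub_eq_zero.1 h0
    refine ⟨α, lt_of_le_of_ne hα.1 ?_, hα.2, Or.inl h0⟩
    rintro rfl
    have := hpos 0
    rw [← h0] at this
    simp at this

theorem sqrt_add_le_sqrt_add_sqrt {a b : ℝ} (ha : 0 ≤ a) (hb : 0 ≤ b) :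
    √(a + b) ≤ √a + √b := by
  refine Real.sqrt_le_iff.2 ⟨by positivity, ?_⟩
  have := mul_nonneg (Real.sqrt_nonneg a) (Real.sqrt_nonneg b)
  nlinarith [Real.sq_sqrt ha, Real.sq_sqrt hb]

/-- Subadditivity of the root separates three contributions. `A` stays as it is, `X` is handled by
AM-GM with weight one, and `Y` by AM-GM weighted so that its coefficient is exactly `ν`. -/
theorem sqrt_mul_le_of_split {S Q A κ X Y L ν : ℝ} (hS : 0 ≤ S) (hA : 0 ≤ A) (hX : 0 ≤ X)
    (hY : 0 ≤ Y) (hL : 0 ≤ L) (hν : 0 < ν) (hQ : Q ≤ A ^ 2 + κ ^ 2 * (X + Y)) :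
    7 * L * √(S * Q) ≤ 7 * L * (√S * A) + 7 / 2 * L * (X + κ ^ 2 * S) + ν * Y
      + 49 / 4 * L ^ 2 * κ ^ 2 * S / ν := by
  have h1 : √(S * Q) ≤ √(S * A ^ 2) + √(κ ^ 2 * S * X) + √(κ ^ 2 * S * Y) := by
    refine (Real.sqrt_le_sqrt (mul_le_mul_of_nonneg_left hQ hS)).trans ?_
    rw [show S * (A ^ 2 + κ ^ 2 * (X + Y)) = (S * A ^ 2 + κ ^ 2 * S * X) + κ ^ 2 * S * Y by ring]
    refine (sqrt_add_le_sqrt_add_sqrt (by positivity) (by positivity)).trans ?_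
    gcongr
    exact sqrt_add_le_sqrt_add_sqrt (by positivity) (by positivity)
  have h2 : √(S * A ^ 2) = √S * A := by rw [Real.sqrt_mul hS, Real.sqrt_sq hA]
  have h3 : √(κ ^ 2 * S * X) ≤ (X + κ ^ 2 * S) / 2 := by
    have hk : 0 ≤ κ ^ 2 * S := by positivity
    refine Real.sqrt_le_iff.2 ⟨by positivity, ?_⟩
    nlinarith [sq_nonneg (X - κ ^ 2 * S)]
  have h4 : 7 * L * √(κ ^ 2 * S * Y) ≤ ν * Y + 49 / 4 * L ^ 2 * κ ^ 2 * S / ν := by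
    have hk : 0 ≤ κ ^ 2 * S := by positivity
    set a := √(κ ^ 2 * S) with ha
    have ha2 : a ^ 2 = κ ^ 2 * S := Real.sq_sqrt hk
    set b := √Y with hb
    have hb2 : b ^ 2 = Y := Real.sq_sqrt hY
    rw [Real.sqrt_mul hk, ← ha, ← hb, show 49 / 4 * L ^ 2 * κ ^ 2 * S = 49 / 4 * L ^ 2 * a ^ 2 by
      rw [ha2]; ring, ← sub_nonneg, ← hb2]
    have : ν * b ^ 2 + 49 / 4 * L ^ 2 * a ^ 2 / ν - 7 * L * (a * b) =
        (ν * b - 7 / 2 * L * a) ^ 2 / ν := by field_simp; ring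
    rw [this]
    positivity
  calc 7 * L * √(S * Q) ≤ 7 * L * (√(S * A ^ 2) + √(κ ^ 2 * S * X) + √(κ ^ 2 * S * Y)) := by gcongr
    _ = 7 * L * (√S * A) + 7 * L * √(κ ^ 2 * S * X) + 7 * L * √(κ ^ 2 * S * Y) := by
        rw [h2]; ring
    _ ≤ 7 * L * (√S * A) + 7 * L * ((X + κ ^ 2 * S) / 2)
        + (ν * Y + 49 / 4 * L ^ 2 * κ ^ 2 * S / ν) := by gcongr
    _ = _ := by ring

theorem sum_range_eq_add_sum_Ico (f : ℕ → ℝ) (a T : ℕ) :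
    ∑ t ∈ range T, f t = ∑ t ∈ range (min a T), f t + ∑ t ∈ Ico a T, f t := by
  rcases le_total a T with h | h
  · rw [min_eq_left h, range_eq_Ico, range_eq_Ico, sum_Ico_consecutive f (Nat.zero_le a) h]
  · rw [min_eq_right h, Ico_eq_empty (by omega), sum_empty, add_zero]

/-! ### Losses -/

namespace IsRegularLoss

variable {L : ℝ} {ℓ : VecYU dy du → ℝ}

theorem nonneg_const (h : IsRegularLoss L ℓ) : 0 ≤ L := by
  have := (h.nonneg 0).trans (h.le 0)
  simpa using this

theorem le_of_norm_le (h : IsRegularLoss L ℓ) {B : ℝ} (hB : 1 ≤ B) {v : VecYU dy du}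
    (hv : ‖v‖ ≤ B) : ℓ v ≤ L * B ^ 2 := by
  refine (h.le v).trans (mul_le_mul_of_nonneg_left (max_le ?_ ?_) h.nonneg_const)
  · nlinarith
  · exact pow_le_pow_left₀ (norm_nonneg _) hv 2

/-- Mean value inequality on the ball of radius `B`, where the gradient is at most `L * B`. -/
theorem sub_le_of_norm_le (h : IsRegularLoss L ℓ) {B : ℝ} (hB : 1 ≤ B) {v w : VecYU dy du}
    (hv : ‖v‖ ≤ B) (hw : ‖w‖ ≤ B) : ℓ v - ℓ w ≤ L * B * ‖v - w‖ := by
  have := (convex_closedBall (0 : VecYU dy du) B).norm_image_sub_le_of_norm_fderiv_le (𝕜 := ℝ)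
    (f := ℓ) (C := L * B) (fun x _ => h.differentiable x) (fun x hx => ?_)
    (mem_closedBall_zero_iff.2 hw) (mem_closedBall_zero_iff.2 hv)
  · exact (le_abs_self _).trans this
  · have h1 : ‖gradient ℓ x‖ = ‖fderiv ℝ ℓ x‖ := by
      rw [gradient, LinearIsometryEquiv.norm_map]
    rw [← h1]
    refine (h.grad_le x).trans (mul_le_mul_of_nonneg_left (max_le hB ?_) h.nonneg_const)
    exact mem_closedBall_zero_iff.1 hx

/-- Moving a point `V` towards `v₀` by the fraction `α` makes room for a perturbation. -/
theorem shrink_add_le (h : IsRegularLoss L ℓ) {α B : ℝ} (hα : 0 < α) (hα1 : α ≤ 1) (hB : 1 ≤ B)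
    {v₀ : VecYU dy du} (hv₀ : ‖v₀‖ ≤ B) (V d : VecYU dy du) :
    ℓ (v₀ + (1 - α) • (V - v₀) + d) ≤ ℓ V + L * (3 * α * B ^ 2 + 2 * ‖d‖ ^ 2 / α) := by
  -- The perturbed point is a convex combination of `V` and `v₀ + d / α`: the perturbation grows by
  -- `1 / α`, but its square is weighted by `α`.
  have e : v₀ + (1 - α) • (V - v₀) + d = (1 - α) • V + α • (v₀ + α⁻¹ • d) := by
    rw [smul_add, smul_smul, mul_inv_cancel₀ hα.ne']
    module
  have h1 := h.convex.2 (Set.mem_univ V) (Set.mem_univ (v₀ + α⁻¹ • d)) (sub_nonneg.2 hα1) hα.le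
    (by ring)
  rw [e]
  have hn : ‖v₀ + α⁻¹ • d‖ ≤ B + ‖d‖ / α := by
    refine (norm_add_le _ _).trans (add_le_add hv₀ ?_)
    rw [norm_smul, Real.norm_of_nonneg (inv_nonneg.2 hα.le), div_eq_inv_mul]
  have hd : 0 ≤ ‖d‖ / α := by positivity
  have hm : ℓ (v₀ + α⁻¹ • d) ≤ L * (3 * B ^ 2 + 2 * (‖d‖ / α) ^ 2) := by
    refine (h.le _).trans (mul_le_mul_of_nonneg_left (max_le (by nlinarith) ?_) h.nonneg_const)
    refine (pow_le_pow_left₀ (norm_nonneg _) hn 2).trans ?_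
    nlinarith [sq_nonneg (B - ‖d‖ / α)]
  have hV := h.nonneg V
  simp only [smul_eq_mul] at h1
  calc _ ≤ (1 - α) * ℓ V + α * ℓ (v₀ + α⁻¹ • d) := h1
    _ ≤ ℓ V + α * (L * (3 * B ^ 2 + 2 * (‖d‖ / α) ^ 2)) := by
        refine add_le_add ?_ (mul_le_mul_of_nonneg_left hm hα.le)
        nlinarith
    _ = _ := by field_simp

end IsRegularLoss

/-! ### The comparator -/

/-- The comparator built from a conversion operator `G` and the estimation error `D`, with
shrinkage factor `β`. -/
def comparatorOp (β : ℝ) (G : ℕ → Matrix (Fin du) (Fin dη) ℝ)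
    (D : ℕ → Matrix (Fin dη) (Fin du) ℝ) : ℕ → Matrix (Fin du) (Fin dη) ℝ :=
  β • G + β ^ 2 • mconv G (mconv D G)

theorem conv_comparatorOp (β : ℝ) (G : ℕ → Matrix (Fin du) (Fin dη) ℝ)
    (D : ℕ → Matrix (Fin dη) (Fin du) ℝ) (x : ℕ → Vec dη) :
    conv (comparatorOp β G D) x = β • conv G x + β ^ 2 • conv G (conv D (conv G x)) := by
  rw [comparatorOp, add_conv, smul_conv, smul_conv, conv_conv D, conv_conv]

/-- The longest term `G D G` reaches lag at most `2 (k - 1) + h`. This is why the algorithm's memory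
must exceed twice the comparator's by `h`. -/
theorem comparatorOp_eq_zero (β : ℝ) {G : ℕ → Matrix (Fin du) (Fin dη) ℝ}
    {D : ℕ → Matrix (Fin dη) (Fin du) ℝ} {k h m : ℕ} (hm1 : 1 ≤ m) (hm : 2 * k + h ≤ m) {i : ℕ}
    (hi : m ≤ i) : comparatorOp β (trunc k G) (trunc (h + 1) D) i = 0 := by
  have hG : ∀ i, k ≤ i → trunc k G i = 0 := fun i hi => if_neg (by omega)
  have hD : ∀ i, h + 1 ≤ i → trunc (h + 1) D i = 0 := fun i hi => if_neg (by omega)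
  have h2 : ∀ i, h + k ≤ i → mconv (trunc (h + 1) D) (trunc k G) i = 0 :=
    fun i hi => mconv_eq_zero hD hG (by omega)
  have h3 : mconv (trunc k G) (mconv (trunc (h + 1) D) (trunc k G)) i = 0 :=
    mconv_eq_zero hG h2 (by omega)
  simp [comparatorOp, hG i (by omega), h3]

theorem massLe_comparatorOp {β : ℝ} (hβ : 0 ≤ β) (hβ1 : β ≤ 1)
    {G : ℕ → Matrix (Fin du) (Fin dη) ℝ} {D : ℕ → Matrix (Fin dη) (Fin du) ℝ} {g ε : ℝ}
    (hG : MassLe G g) (hD : MassLe D ε) : MassLe (comparatorOp β G D) (g + g * (ε * g)) := by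
  intro T
  refine ((hG.smul hβ).add ((hG.mconv (hD.mconv hG)).smul (sq_nonneg β)) T).trans ?_
  have := hG.nonneg
  have := hD.nonneg
  have : 0 ≤ g * (ε * g) := by positivity
  refine add_le_add ?_ ?_
  · exact mul_le_of_le_one_left ‹_› hβ1
  · exact mul_le_of_le_one_left ‹_› (pow_le_one₀ hβ hβ1)

/-- The inputs of the comparator differ from the shrunk inputs of the policy by truncation errors,
a first-order term that involves the distance of the inputs played to those of the comparator, and
a second-order term. -/
theorem smul_conv_sub_conv_comparator {β : ℝ} {Gc G Gt : ℕ → Matrix (Fin du) (Fin dη) ℝ}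
    {D Dh Dt : ℕ → Matrix (Fin dη) (Fin du) ℝ} (hG : G + Gt = Gc) (hD : Dh + Dt = D)
    {u w : ℕ → Vec du} {n x : ℕ → Vec dη} (hx : x = n - conv D u)
    (hw : w = conv (comparatorOp β G Dh) x) :
    β • conv Gc n - w = β • conv Gt n + β • conv G (conv Dt u) + β • conv G (conv Dh (u - w))
      + β ^ 3 • conv G (conv Dh (conv G (conv Dh (conv G x)))) := by
  -- Nature's signal is written through the observed `x`. The part of `conv Dh u` due to `w` then
  -- cancels the second-order term of the comparator, up to the cubic remainder.
  have hn : n = x + (conv Dh u + conv Dt u) := by rw [hx, ← add_conv, hD]; abel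
  have h1 : conv Gc n = conv G x + conv G (conv Dh u) + conv G (conv Dt u) + conv Gt n := by
    rw [← hG, add_conv]
    nth_rewrite 1 [hn]
    rw [conv_add, conv_add]
    abel
  have h2 : conv G (conv Dh (u - w)) = conv G (conv Dh u) - (β • conv G (conv Dh (conv G x))
      + β ^ 2 • conv G (conv Dh (conv G (conv Dh (conv G x))))) := by
    rw [hw, conv_comparatorOp, conv_sub, conv_add, conv_smul, conv_smul, conv_sub, conv_add,
      conv_smul, conv_smul]
  rw [h1, h2, hw, conv_comparatorOp]
  module

theorem IsStableOperator.massLe {ι κ : Type} [Fintype ι] [Fintype κ] [DecidableEq κ]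
    {G : ℕ → Matrix ι κ ℝ} {R : ℝ} {ψ : ℕ → ℝ} (h : IsStableOperator G R ψ) : MassLe G R :=
  .of_tsum h.summable h.norm_le

namespace IsMarkovEstimate

variable {h : ℕ} {ε : ℝ} {G Ghat : ℕ → Matrix (Fin dη) (Fin du) ℝ}

theorem massLe_error (H : IsMarkovEstimate h ε G Ghat) : MassLe (tailFrom 1 (Ghat - G)) ε := by
  refine (MassLe.of_tsum (G := Ghat - G) H.summable H.error_le).mono fun i => ?_
  by_cases hi : i < 1 <;> simp [tailFrom, hi]

/-- Beyond lag `h` the error is either zero or minus the true Markov parameter, so the decay of `G`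
controls it. -/
theorem massLe_error_tail (H : IsMarkovEstimate h ε G Ghat) {R θ : ℝ} {ψ : ℕ → ℝ}
    (hG : IsStableOperator G R ψ) (hψ : ψ (h + 1) ≤ θ) :
    MassLe (tailFrom (h + 1) (tailFrom 1 (Ghat - G))) θ := by
  refine (massLe_tailFrom hG.summable ((hG.decay_le _).trans hψ)).mono fun i => ?_
  by_cases hi : i < h + 1
  · simp [tailFrom, hi]
  · rcases H.tail i (by omega) with e | e
    · have h0 : i ≠ 0 := by omega
      simp [tailFrom, hi, h0, e]
    · simp [tailFrom, hi, e]

end IsMarkovEstimate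

/-! ### Boundedness of the algorithm -/

/-- Bound on the exogenous inputs of the algorithm. -/
def Params.inputBound (p : Params) (du : ℕ) : ℝ := max (p.Ruest du) (2 * p.RM * p.Rnat)

theorem Params.Admissible.log_nonneg {p : Params} (hp : p.Admissible) :
    0 ≤ Real.log (1 / p.δ) :=
  Real.log_nonneg (by rw [one_div]; exact (one_le_inv₀ hp.δ_pos).2 hp.δ_lt_one.le)

theorem Params.Admissible.inputBound_sq_le {p : Params} (hp : p.Admissible) (du : ℕ) :
    p.inputBound du ^ 2 ≤ 9 * (du + Real.log (1 / p.δ) + p.RM ^ 4 * p.Rnat ^ 2) := by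
  have h0 := hp.log_nonneg
  have h1 := hp.one_le_RM
  have h2 : 0 ≤ p.RM ^ 4 * p.Rnat ^ 2 := by positivity
  rcases max_choice (p.Ruest du) (2 * p.RM * p.Rnat) with h | h
  · rw [Params.inputBound, h, Params.Ruest, mul_pow, Real.sq_sqrt (by positivity)]
    nlinarith
  · rw [Params.inputBound, h]
    have : p.RM ^ 2 * p.Rnat ^ 2 ≤ p.RM ^ 4 * p.Rnat ^ 2 :=
      mul_le_mul_of_nonneg_right (pow_le_pow_right₀ h1 (by norm_num)) (sq_nonneg _)
    have : (0 : ℝ) ≤ du := du.cast_nonneg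
    nlinarith

theorem Params.Admissible.le_inputBound {p : Params} (hp : p.Admissible) (du : ℕ) :
    2 * p.Rnat ≤ p.inputBound du := by
  have h1 := hp.one_le_RM
  have h2 := hp.one_le_Rnat
  refine le_trans ?_ (le_max_right _ _)
  nlinarith

theorem GoodExploration.mul_le_one {p : Params} {ξ : ℕ → Vec du} (hξ : GoodExploration p ξ)
    (hp : p.Admissible) (hR : 1 ≤ p.R0) : p.ε * (2 * p.RM * p.R0) ≤ 1 ∧ p.ε * p.Ruest du ≤ 1 := by
  have h1 := hp.one_le_RM
  have hpos : 0 < max (p.Ruest du) (2 * p.RM * p.R0) := lt_max_of_lt_right (by positivity)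
  have h : p.ε * max (p.Ruest du) (2 * p.RM * p.R0) ≤ 1 := (le_div_iff₀ hpos).1 hξ.ε_le
  rcases le_total p.ε 0 with h0 | h0
  · have : 0 ≤ p.Ruest du := by unfold Params.Ruest; positivity
    constructor
    · exact (mul_nonpos_of_nonpos_of_nonneg h0 (by positivity)).trans zero_le_one
    · exact (mul_nonpos_of_nonpos_of_nonneg h0 this).trans zero_le_one
  · exact ⟨(mul_le_mul_of_nonneg_left (le_max_right _ _) h0).trans h,
      (mul_le_mul_of_nonneg_left (le_max_left _ _) h0).trans h⟩

/-- The accuracy requirement keeps the reconstruction error below `Rnat`; hence the factor `2 *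
Rnat` in all later bounds on the reconstruction. -/
theorem GoodExploration.mul_inputBound_le {p : Params} {ξ : ℕ → Vec du} (hξ : GoodExploration p ξ)
    (hp : p.Admissible) (hR : 1 ≤ p.R0) (hε : 0 ≤ p.ε) : p.ε * p.inputBound du ≤ p.Rnat := by
  obtain ⟨h1, h2⟩ := hξ.mul_le_one hp hR
  have h3 := hp.one_le_Rnat
  have h4 := hp.one_le_RM
  rw [Params.inputBound, mul_max_of_nonneg _ _ hε]
  refine max_le (h2.trans h3) ?_
  have : p.ε * (2 * p.RM) ≤ 1 := by
    calc p.ε * (2 * p.RM) ≤ p.ε * (2 * p.RM) * p.R0 := le_mul_of_one_le_right (by positivity) hR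
      _ = p.ε * (2 * p.RM * p.R0) := by ring
      _ ≤ 1 := h1
  nlinarith

section Bounds

variable {P : Instance dx ds dy du dη} {p : Params} {ξ : ℕ → Vec du}
  {Ghatη : ℕ → Matrix (Fin dη) (Fin du) ℝ} {M : ℕ → Fin p.m → Matrix (Fin du) (Fin dη) ℝ}

theorem norm_ηHat_le (hp : p.Admissible) (hP : P.Regular p) (hξ : GoodExploration p ξ)
    (hη : IsMarkovEstimate p.h p.ε P.Gη Ghatη) (hR : 1 ≤ p.R0) {u : ℕ → Vec du} {t : ℕ}
    (hu : ∀ j < t, ‖u j‖ ≤ p.inputBound du) : ‖P.ηHat Ghatη u t‖ ≤ 2 * p.Rnat := by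
  have hD := hη.massLe_error
  have hU : 0 ≤ p.inputBound du := by linarith [hp.le_inputBound du, hp.one_le_Rnat]
  have h1 : ‖conv (tailFrom 1 (Ghatη - P.Gη)) u t‖ ≤ p.ε * p.inputBound du := by
    refine norm_conv_le hD hU fun j hj => ?_
    rcases hj.lt_or_eq with h | rfl
    · exact Or.inr (hu j h)
    · left; simp [tailFrom]
  rw [P.ηHat_eq, Pi.sub_apply]
  have h2 := hξ.mul_inputBound_le hp hR hD.nonneg
  have h3 := hP.ηNat_le t
  have h4 := norm_sub_le (P.ηNat t) (conv (tailFrom 1 (Ghatη - P.Gη)) u t)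
  linarith

/-- Strong induction: inputs bounded before `t` keep the reconstruction below `2 * Rnat`, so the
next input is at most `RM * (2 * Rnat)`. The bound does not deteriorate over time. -/
theorem norm_algInput_le (hp : p.Admissible) (hP : P.Regular p) (hξ : GoodExploration p ξ)
    (hη : IsMarkovEstimate p.h p.ε P.Gη Ghatη) (hR : 1 ≤ p.R0)
    (hM : ∀ t, M t ∈ drcClass du dη p.m p.RM) (t : ℕ) :
    ‖P.algInput p.N ξ Ghatη M t‖ ≤ p.inputBound du := by
  induction t using Nat.strong_induction_on with
  | _ t ih =>
    rcases lt_or_ge t p.N with h | h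
    · rw [P.algInput_of_lt ξ Ghatη M h]
      exact (hξ.input_le t h).trans (le_max_left _ _)
    · rw [P.algInput_of_le ξ Ghatη M h]
      refine (norm_drcInput_le (hM t) fun s hs => norm_ηHat_le hp hP hξ hη hR fun j hj =>
        ih j (lt_of_lt_of_le hj hs)).trans (le_trans (le_of_eq ?_) (le_max_right _ _))
      ring

end Bounds

/-- When the control inputs have positive dimension, the bound on `G_{ex → v}` is at least `1`. -/
theorem one_le_of_isStableOperator_Gv {P : Instance dx ds dy du dη} {R : ℝ} {ψ : ℕ → ℝ}
    (h : IsStableOperator P.Gv R ψ) (hdu : du ≠ 0) : 1 ≤ R := by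
  have : NeZero du := ⟨hdu⟩
  have h1 : ‖P.Gv 0‖ ≤ R := by simpa using h.massLe 1
  refine le_trans ?_ h1
  have h2 := norm_act_le (P.Gv 0) (EuclideanSpace.single (0 : Fin du) (1 : ℝ))
  have h3 : P.Gv 0 *ₑ EuclideanSpace.single (0 : Fin du) (1 : ℝ) =
      joinVec 0 (EuclideanSpace.single (0 : Fin du) (1 : ℝ)) := by
    rw [Instance.Gv, fromRows_act, zero_act, one_act]
  have h4 : ‖joinVec (0 : Vec dy) (EuclideanSpace.single (0 : Fin du) (1 : ℝ))‖ = 1 := by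
    rw [EuclideanSpace.norm_eq, Fintype.sum_sum_type]
    simp [joinVec]
  rw [h3, h4] at h2
  simpa using h2

/-- Deviation of the comparator's truncated response from the shrunk response of the policy. -/
theorem norm_comparator_response_sub_le {Gv : ℕ → Matrix (Fin dy ⊕ Fin du) (Fin du) ℝ}
    {Gc : ℕ → Matrix (Fin du) (Fin dη) ℝ} {D : ℕ → Matrix (Fin dη) (Fin du) ℝ}
    {R0 Rs ε θ₁ θ₂ Rn U β : ℝ} {k h : ℕ} (hGv : MassLe Gv R0) (hGc : MassLe Gc Rs)
    (hD : MassLe D ε) (hGv' : MassLe (tailFrom (h + 1) Gv) θ₂) (hGc' : MassLe (tailFrom k Gc) θ₁)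
    (hD' : MassLe (tailFrom (h + 1) D) θ₂) (hβ : 0 ≤ β) (hβ1 : β ≤ 1) {u w : ℕ → Vec du}
    {n x : ℕ → Vec dη} (hn : ∀ t, ‖n t‖ ≤ Rn) (hx : ∀ t, ‖x t‖ ≤ 2 * Rn) (hu : ∀ t, ‖u t‖ ≤ U)
    (hxn : x = n - conv D u)
    (hw : w = conv (comparatorOp β (trunc k Gc) (trunc (h + 1) D)) x) (t : ℕ) :
    ‖conv (trunc (h + 1) Gv) w t - β • conv Gv (conv Gc n) t‖ ≤
      θ₂ * (Rs * Rn) + R0 * (θ₁ * Rn) + R0 * (Rs * (θ₂ * U))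
        + R0 * (Rs * (ε * (Rs * (ε * (Rs * (2 * Rn))))))
      + ‖conv (trunc (h + 1) Gv) (conv (trunc k Gc) (conv (trunc (h + 1) D) (u - w))) t‖ := by
  have key := smul_conv_sub_conv_comparator (β := β) (trunc_add_tailFrom k Gc)
    (trunc_add_tailFrom (h + 1) D) hxn hw
  set V := trunc (h + 1) Gv with hV
  set G := trunc k Gc with hG
  set E := trunc (h + 1) D with hE
  have mV : MassLe V R0 := hGv.trunc _
  have mG : MassLe G Rs := hGc.trunc _
  have mE : MassLe E ε := hD.trunc _
  -- The tail of `Gv` acts on the policy's inputs, and the truncated operator on the difference of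
  -- inputs given by `key`.
  have e : conv V w - β • conv Gv (conv Gc n) =
      -(β • conv (tailFrom (h + 1) Gv) (conv Gc n) + (β • conv V (conv (tailFrom k Gc) n)
        + β • conv V (conv G (conv (tailFrom (h + 1) D) u))
        + β ^ 3 • conv V (conv G (conv E (conv G (conv E (conv G x)))))
        + β • conv V (conv G (conv E (u - w))))) := by
    have h1 : conv Gv (conv Gc n) = conv V (conv Gc n) + conv (tailFrom (h + 1) Gv) (conv Gc n) := by
      rw [← add_conv, trunc_add_tailFrom]
    have h2 := congrArg (conv V) key
    simp only [conv_sub V, conv_add V, conv_smul V] at h2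
    have h3 : conv V w = β • conv V (conv Gc n) - (β • conv V (conv Gc n) - conv V w) := by abel
    rw [h3, h2, h1]
    module
  have e' := congrFun e t
  simp only [Pi.sub_apply, Pi.smul_apply, Pi.neg_apply, Pi.add_apply] at e'
  rw [e', norm_neg]
  have b1 := norm_conv_le' hGv' (norm_conv_le' hGc hn) t
  have b2 := norm_conv_le' mV (norm_conv_le' hGc' hn) t
  have b3 := norm_conv_le' mV (norm_conv_le' mG (norm_conv_le' hD' hu)) t
  have b4 := norm_conv_le' mV (norm_conv_le' mG (norm_conv_le' mE (norm_conv_le' mG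
    (norm_conv_le' mE (norm_conv_le' mG hx))))) t
  have sm : ∀ (r : ℝ) (_ : 0 ≤ r) (_ : r ≤ 1) (z : VecYU dy du), ‖r • z‖ ≤ ‖z‖ := by
    intro r h0 h1 z
    rw [norm_smul, Real.norm_of_nonneg h0]
    exact mul_le_of_le_one_left (norm_nonneg _) h1
  have hβ3 : β ^ 3 ≤ 1 := pow_le_one₀ hβ hβ1
  refine (norm_add_le _ _).trans (le_trans (add_le_add ((sm β hβ hβ1 _).trans b1)
    ((norm_add_le _ _).trans (add_le_add ((norm_add_le _ _).trans (add_le_add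
      ((norm_add_le _ _).trans (add_le_add ((sm β hβ hβ1 _).trans b2) ((sm β hβ hβ1 _).trans b3)))
      ((sm _ (by positivity) hβ3 _).trans b4))) (sm β hβ hβ1 _)))) (le_of_eq ?_))
  ring

/-- Deterministic part of the deviation of the comparator's response. -/
def Params.deviation (p : Params) (du : ℕ) : ℝ :=
  p.c * p.R0 ^ 2 * p.RM * p.inputBound du / p.T + p.R0 * p.RM ^ 3 * p.ε ^ 2 * p.Rnat

theorem Params.Admissible.T_pos {p : Params} (hp : p.Admissible) : (0 : ℝ) < p.T :=
  Nat.cast_pos.2 hp.one_le_T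

theorem Params.Admissible.deviation_pos {p : Params} (hp : p.Admissible) (hR : 1 ≤ p.R0) :
    0 < p.deviation du := by
  have h1 := hp.T_pos
  have h2 := hp.one_le_c
  have h3 := hp.one_le_RM
  have h4 := hp.one_le_Rnat
  have h5 : 0 < p.inputBound du := by linarith [hp.le_inputBound du]
  have : 0 ≤ p.R0 * p.RM ^ 3 * p.ε ^ 2 * p.Rnat := by positivity
  have : 0 < p.c * p.R0 ^ 2 * p.RM * p.inputBound du / p.T := by positivity
  unfold Params.deviation
  linarith

/-- The three truncation terms merge because `2 * Rnat ≤ U ≤ R0 * U`, with `U` the input bound; the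
factor `2` of the quadratic term is absorbed by `(2 * Rstar) ^ 3 ≤ RM ^ 3`. -/
theorem Params.Admissible.deviation_terms_le {p : Params} (hp : p.Admissible) (hR : 1 ≤ p.R0)
    (hs : 0 ≤ p.Rstar) :
    p.c * p.R0 / p.T * (p.Rstar * p.Rnat) + p.R0 * (p.c * p.Rstar / p.T * p.Rnat)
      + p.R0 * (p.Rstar * (p.c * p.R0 / p.T * p.inputBound du))
      + p.R0 * (p.Rstar * (p.ε * (p.Rstar * (p.ε * (p.Rstar * (2 * p.Rnat))))))
      ≤ p.deviation du := by
  have h1 := hp.T_pos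
  have h2 := hp.one_le_c
  have h3 := hp.one_le_RM
  have h4 := hp.one_le_Rnat
  have h5 := hp.le_inputBound du
  have h6 := hp.two_Rstar_le_RM
  have h7 : 0 ≤ p.inputBound du := by linarith
  have e1 : p.c * p.R0 / p.T * (p.Rstar * p.Rnat) + p.R0 * (p.c * p.Rstar / p.T * p.Rnat)
      + p.R0 * (p.Rstar * (p.c * p.R0 / p.T * p.inputBound du)) =
      p.c * p.R0 * (p.Rstar * (2 * p.Rnat + p.R0 * p.inputBound du)) / p.T := by
    field_simp
    ring
  have e2 : p.R0 * (p.Rstar * (p.ε * (p.Rstar * (p.ε * (p.Rstar * (2 * p.Rnat)))))) =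
      p.R0 * (2 * p.Rstar ^ 3) * p.ε ^ 2 * p.Rnat := by ring
  have i1 : 2 * p.Rnat + p.R0 * p.inputBound du ≤ 2 * (p.R0 * p.inputBound du) := by nlinarith
  have i2 : p.Rstar * (2 * p.Rnat + p.R0 * p.inputBound du) ≤
      p.RM * (p.R0 * p.inputBound du) := by
    calc _ ≤ p.Rstar * (2 * (p.R0 * p.inputBound du)) := mul_le_mul_of_nonneg_left i1 hs
      _ = 2 * p.Rstar * (p.R0 * p.inputBound du) := by ring
      _ ≤ _ := mul_le_mul_of_nonneg_right h6 (by positivity)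
  have i3 : 2 * p.Rstar ^ 3 ≤ p.RM ^ 3 := by
    have := pow_le_pow_left₀ (by positivity) h6 3
    nlinarith [pow_nonneg hs 3]
  rw [e1, e2, Params.deviation]
  refine add_le_add (div_le_div_of_nonneg_right ?_ h1.le) ?_
  · calc _ ≤ p.c * p.R0 * (p.RM * (p.R0 * p.inputBound du)) :=
          mul_le_mul_of_nonneg_left i2 (by positivity)
      _ = _ := by ring
  · gcongr

theorem sum_fin_norm_le {m : ℕ} {H : ℕ → Matrix (Fin du) (Fin dη) ℝ} {g : ℝ} (hH : MassLe H g) :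
    ∑ i : Fin m, ‖H i‖ ≤ g := by
  rw [Fin.sum_univ_eq_sum_range (fun i => ‖H i‖) m]
  exact hH m

/-- Total squared distance of the inputs `u` to those of the controller parameter `M`. -/
def inputDist {m : ℕ} (T : ℕ) (u : ℕ → Vec du) (η : ℕ → Vec dη)
    (M : Fin m → Matrix (Fin du) (Fin dη) ℝ) : ℝ :=
  ∑ t ∈ range T, ‖u t - drcInput M η t‖ ^ 2

/-! ### Domination of a benchmark policy by a parameter of the algorithm. -/

section Comparator

variable {P : Instance dx ds dy du dη} {p : Params} {u : ℕ → Vec du} {x : ℕ → Vec dη}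
  {Ghatη : ℕ → Matrix (Fin dη) (Fin du) ℝ} {π : LDC dy du}

/-- Every benchmark policy is dominated by a parameter of the algorithm, up to an error that is of
second order in the estimation error except for the distance of the inputs. -/
theorem exists_comparator (hp : p.Admissible) (hP : P.Regular p) (hR : 1 ≤ p.R0)
    (hη : IsMarkovEstimate p.h p.ε P.Gη Ghatη) (hε : p.ε * (2 * p.RM * p.R0) ≤ 1)
    (hu : ∀ t, ‖u t‖ ≤ p.inputBound du) (hx : x = P.ηHat Ghatη u) (hxb : ∀ t, ‖x t‖ ≤ 2 * p.Rnat)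
    (hπ : π ∈ P.policyClass p.Rstar p.ψstar) (a : ℕ) :
    ∃ Mstar ∈ drcClass du dη p.m p.RM,
      ∑ t ∈ Ico a p.T, (P.memLoss p.h x t (fun _ => embed Mstar) - P.loss t (P.ldcV π t)) ≤
        7 * p.L * √(p.Rnat ^ 2 * p.T * (p.deviation du ^ 2 * p.T
          + (p.R0 * p.RM * p.ε) ^ 2 * inputDist p.T u x Mstar)) := by
  obtain ⟨Gc, hconv, hsum, hl1, hdec⟩ := hπ
  have mGc : MassLe Gc p.Rstar := .of_tsum hsum hl1
  have hs := mGc.nonneg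
  set D := tailFrom 1 (Ghatη - P.Gη) with hD
  have mD : MassLe D p.ε := hη.massLe_error
  have hε0 := mD.nonneg
  have hT := hp.T_pos
  have hRM := hp.one_le_RM
  have hRn := hp.one_le_Rnat
  have hL : 0 ≤ p.L := (hP.loss 0).nonneg_const
  have h2s := hp.two_Rstar_le_RM
  have hθ₂ : MassLe (tailFrom (p.h + 1) D) (p.c * p.R0 / p.T) :=
    hη.massLe_error_tail hP.Gη hp.ψ0_le
  have hθ₂' : MassLe (tailFrom (p.h + 1) P.Gv) (p.c * p.R0 / p.T) :=
    massLe_tailFrom hP.Gv.summable ((hP.Gv.decay_le _).trans hp.ψ0_le)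
  have hθ₁ : MassLe (tailFrom p.mstar Gc) (p.c * p.Rstar / p.T) :=
    massLe_tailFrom hsum ((hdec _).trans hp.ψstar_le)
  set G := trunc p.mstar Gc with hG
  set E := trunc (p.h + 1) D with hE
  have mG : MassLe G p.Rstar := mGc.trunc _
  have mE : MassLe E p.ε := mD.trunc _
  have mV : MassLe (trunc (p.h + 1) P.Gv) p.R0 := hP.Gv.massLe.trunc _
  -- One candidate for each shrinkage `1 - α`; the played inputs `u` and the reconstruction `x` do
  -- not depend on `α`, so the input distance is continuous in `α`.
  let Mc : ℝ → Fin p.m → Matrix (Fin du) (Fin dη) ℝ := fun α i => comparatorOp (1 - α) G E i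
  have hMc : ∀ α, (fun t => drcInput (Mc α) x t) = conv (comparatorOp (1 - α) G E) x := fun α =>
    funext fun t => drcInput_eq_conv (fun i hi => comparatorOp_eq_zero _ hp.one_le_m hp.m_ge hi) x t
  have hcont : Continuous fun α => inputDist p.T u x (Mc α) := by
    have : (fun α => inputDist p.T u x (Mc α)) = fun α => ∑ t ∈ range p.T,
        ‖u t - ((1 - α) • conv G x t + (1 - α) ^ 2 • conv G (conv E (conv G x)) t)‖ ^ 2 := by
      funext α
      refine sum_congr rfl fun t _ => ?_
      rw [show drcInput (Mc α) x t = _ from congrFun (hMc α) t, conv_comparatorOp]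
      rfl
    rw [this]
    fun_prop
  have hXnn : ∀ α, 0 ≤ inputDist p.T u x (Mc α) := fun α => sum_nonneg fun _ _ => sq_nonneg _
  have hτ : 0 < p.deviation du := hp.deviation_pos hR
  set κ := p.R0 * p.RM * p.ε with hκ
  set τ := p.deviation du with hτdef
  set S := p.Rnat ^ 2 * p.T with hS
  have hS0 : 0 ≤ S := by positivity
  let Q : ℝ → ℝ := fun α => τ ^ 2 * p.T + κ ^ 2 * inputDist p.T u x (Mc α)
  have hQpos : ∀ α, 0 < Q α := fun α => by
    have := hXnn α
    have : 0 < τ ^ 2 * p.T := by positivity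
    have : 0 ≤ κ ^ 2 * inputDist p.T u x (Mc α) := by positivity
    exact add_pos_of_pos_of_nonneg ‹_› ‹_›
  -- Balance between the shrinkage cost `α * S` and the perturbation cost `Q α / α`.
  obtain ⟨α, hα0, hα1, hα⟩ := exists_balanced_weight (Q := Q) (by fun_prop) hQpos (S := S)
  have hmem : Mc α ∈ drcClass du dη p.m p.RM := by
    refine (sum_fin_norm_le (massLe_comparatorOp (sub_nonneg.2 hα1) (by linarith) mG mE)).trans ?_
    -- With this the correction `G D G` has mass at most `Rstar`, and the whole comparator at most
    -- `2 * Rstar ≤ RM`.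
    have : p.ε * p.Rstar ≤ 1 := by
      refine le_trans (mul_le_mul_of_nonneg_left ?_ hε0) hε
      nlinarith
    nlinarith
  refine ⟨Mc α, hmem, ?_⟩
  have hmemLoss : ∀ t, P.memLoss p.h x t (fun _ => embed (Mc α)) =
      P.loss t (P.vNat t + conv (trunc (p.h + 1) P.Gv) (conv (comparatorOp (1 - α) G E) x) t) := by
    intro t
    rw [← hMc α]
    exact P.memLoss_embed p.h x t fun _ => Mc α
  simp only [hmemLoss]
  rcases hα with hα | ⟨rfl, hSQ⟩
  · set w := conv (comparatorOp (1 - α) G E) x with hw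
    set yy := conv (trunc (p.h + 1) P.Gv) (conv G (conv E (u - w))) with hyy
    have hX : ∑ t ∈ range p.T, ‖(u - w) t‖ ^ 2 = inputDist p.T u x (Mc α) := by
      rw [inputDist]
      refine sum_congr rfl fun t _ => ?_
      rw [show drcInput (Mc α) x t = _ from congrFun (hMc α) t]
      rfl
    -- Young's inequality three times, once for each operator in `yy`.
    have hyX : ∑ t ∈ range p.T, ‖yy t‖ ^ 2 ≤ κ ^ 2 * inputDist p.T u x (Mc α) := by
      have h1 := sum_norm_conv_sq_le mV (conv G (conv E (u - w))) p.T
      have h2 := sum_norm_conv_sq_le mG (conv E (u - w)) p.T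
      have h3 := sum_norm_conv_sq_le mE (u - w) p.T
      rw [hX] at h3
      calc _ ≤ p.R0 ^ 2 * (p.Rstar ^ 2 * (p.ε ^ 2 * inputDist p.T u x (Mc α))) :=
            h1.trans (mul_le_mul_of_nonneg_left (h2.trans
              (mul_le_mul_of_nonneg_left h3 (sq_nonneg _))) (sq_nonneg _))
        _ = (p.R0 * p.Rstar * p.ε) ^ 2 * inputDist p.T u x (Mc α) := by ring
        _ ≤ _ := by
          refine mul_le_mul_of_nonneg_right (pow_le_pow_left₀ (by positivity) ?_ 2) (hXnn α)
          rw [hκ]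
          gcongr
          linarith
    have hd : ∀ t, ‖conv (trunc (p.h + 1) P.Gv) w t - (1 - α) • conv P.Gv (conv Gc P.ηNat) t‖ ≤
        τ + ‖yy t‖ := by
      intro t
      refine (norm_comparator_response_sub_le hP.Gv.massLe mGc mD hθ₂' hθ₁ hθ₂ (sub_nonneg.2 hα1)
        (by linarith) hP.ηNat_le hxb hu (hx.trans (P.ηHat_eq _ _)) hw t).trans ?_
      exact add_le_add_left (hp.deviation_terms_le hR hs) _
    have hstep : ∀ t, P.loss t (P.vNat t + conv (trunc (p.h + 1) P.Gv) w t)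
        - P.loss t (P.ldcV π t) ≤
        p.L * (3 * α * p.Rnat ^ 2 + 4 * τ ^ 2 / α + 4 * ‖yy t‖ ^ 2 / α) := by
      intro t
      have e : P.vNat t + conv (trunc (p.h + 1) P.Gv) w t =
          P.vNat t + (1 - α) • (P.ldcV π t - P.vNat t) +
          (conv (trunc (p.h + 1) P.Gv) w t - (1 - α) • conv P.Gv (conv Gc P.ηNat) t) := by
        rw [congrFun (P.ldcV_eq hconv) t, Pi.add_apply]
        module
      rw [e, sub_le_iff_le_add']
      refine ((hP.loss t).shrink_add_le hα0 hα1 hRn (hP.vNat_le t) _ _).trans ?_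
      refine add_le_add_right (mul_le_mul_of_nonneg_left ?_ hL) _
      rw [add_assoc, ← add_div]
      refine add_le_add_right (div_le_div_of_nonneg_right ?_ hα0.le) _
      have := pow_le_pow_left₀ (norm_nonneg _) (hd t) 2
      nlinarith [sq_nonneg (τ - ‖yy t‖)]
    have hnn : ∀ t, 0 ≤ p.L * (3 * α * p.Rnat ^ 2 + 4 * τ ^ 2 / α + 4 * ‖yy t‖ ^ 2 / α) :=
      fun t => by positivity
    have hQ : τ ^ 2 * p.T + ∑ t ∈ range p.T, ‖yy t‖ ^ 2 ≤ Q α := add_le_add_right hyX _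
    calc _ ≤ ∑ t ∈ Ico a p.T, p.L * (3 * α * p.Rnat ^ 2 + 4 * τ ^ 2 / α + 4 * ‖yy t‖ ^ 2 / α) :=
          sum_le_sum fun t _ => hstep t
      _ ≤ ∑ t ∈ range p.T, p.L * (3 * α * p.Rnat ^ 2 + 4 * τ ^ 2 / α + 4 * ‖yy t‖ ^ 2 / α) := by
          refine sum_le_sum_of_subset_of_nonneg (fun t ht => ?_) fun t _ _ => hnn t
          exact mem_range.2 (mem_Ico.1 ht).2
      _ = p.L * (3 * α * S + 4 * (τ ^ 2 * p.T + ∑ t ∈ range p.T, ‖yy t‖ ^ 2) / α) := by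
          rw [← mul_sum, sum_add_distrib, sum_const, card_range, ← sum_div, ← mul_sum, hS,
            nsmul_eq_mul]
          ring
      _ ≤ p.L * (3 * α * S + 4 * Q α / α) := by gcongr
      -- At the balance point `Q α / α = α * S`, so the constants add up to `3 + 4`, and `α * S` is
      -- the geometric mean of `S` and `Q α`.
      _ = 7 * p.L * (α * S) := by rw [← hα]; field_simp; ring
      _ = _ := by
          change _ = 7 * p.L * √(S * Q α)
          rw [← hα, show S * (α ^ 2 * S) = (α * S) ^ 2 by ring, Real.sqrt_sq (by positivity)]
  · have h0 : comparatorOp (1 - 1) G E = 0 := by simp [comparatorOp]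
    have h1 : ∀ t, conv (trunc (p.h + 1) P.Gv) (conv (comparatorOp (1 - 1) G E) x) t = 0 := by
      intro t
      rw [h0]
      simp [conv, zero_act, act_zero]
    calc _ ≤ ∑ t ∈ Ico a p.T, p.L * p.Rnat ^ 2 := by
          refine sum_le_sum fun t _ => ?_
          rw [h1, add_zero]
          have := (hP.loss t).le_of_norm_le hRn (hP.vNat_le t)
          have := (hP.loss t).nonneg (P.ldcV π t)
          linarith
      _ ≤ ∑ t ∈ range p.T, p.L * p.Rnat ^ 2 := by
          refine sum_le_sum_of_subset_of_nonneg (fun t ht => ?_) fun t _ _ => by positivity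
          exact mem_range.2 (mem_Ico.1 ht).2
      _ = p.L * √(S * S) := by
          rw [sum_const, card_range, nsmul_eq_mul, Real.sqrt_mul_self hS0]
          ring
      _ ≤ p.L * √(S * Q 1) := by gcongr
      _ ≤ 7 * p.L * √(S * Q 1) := by
          have := mul_nonneg hL (Real.sqrt_nonneg (S * Q 1))
          linarith

end Comparator

/-- The infimum need not be attained, so a near-minimizer with slack `L` is used. For `L = 0` all
losses vanish and any policy serves. -/
theorem exists_mem_sum_loss_le {P : Instance dx ds dy du dη} {p : Params} (hP : P.Regular p)
    {Pi : Set (LDC dy du)} (hPi : Pi.Nonempty) :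
    ∃ π ∈ Pi, ∑ t ∈ range p.T, P.loss t (P.ldcV π t) ≤
      sInf ((fun π => ∑ t ∈ range p.T, P.loss t (P.ldcV π t)) '' Pi) + p.L := by
  rcases (hP.loss 0).nonneg_const.eq_or_lt with h | h
  · obtain ⟨π, hπ⟩ := hPi
    have h0 : ∀ t v, P.loss t v ≤ 0 := fun t v => by simpa [← h] using (hP.loss t).le v
    refine ⟨π, hπ, (sum_nonpos fun t _ => h0 _ _).trans ?_⟩
    rw [← h, add_zero]
    refine Real.sInf_nonneg ?_
    rintro _ ⟨π', _, rfl⟩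
    exact sum_nonneg fun t _ => (hP.loss t).nonneg _
  · obtain ⟨_, ⟨π, hπ, rfl⟩, h1⟩ := Real.lt_sInf_add_pos (hPi.image _) h
    exact ⟨π, hπ, h1.le⟩

/-- The right-hand side of the regret bound, without memory regret and curvature term. -/
def Params.residual (p : Params) (du : ℕ) (K ν : ℝ) : ℝ :=
  K * (p.L * p.R0 ^ 3 * (p.N + p.c * p.m)) * (du + Real.log (1 / p.δ) + p.RM ^ 4 * p.Rnat ^ 2)
    + K * (p.L * p.RM ^ 3 * p.R0 ^ 2 * p.Rnat ^ 2 * p.T * p.ε ^ 2) * (1 + p.L * p.m * p.R0 ^ 2 / ν)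

theorem Params.Admissible.residual_nonneg {p : Params} (hp : p.Admissible) (hL : 0 ≤ p.L)
    (hR : 0 ≤ p.R0) {K ν : ℝ} (hK : 0 ≤ K) (hν : 0 < ν) : 0 ≤ p.residual du K ν := by
  have := hp.log_nonneg
  have : 0 ≤ p.c := zero_le_one.trans hp.one_le_c
  have : 0 ≤ p.RM := zero_le_one.trans hp.one_le_RM
  unfold Params.residual
  positivity

/-- The summands are, in order: start-up loss, memory truncation, deviation of the comparator,
start-up input distance together with its AM-GM partner, the price of the curvature term, and the
slack of the infimum. Terms without `ε` reduce to multiples of `W` through the bound on the squared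
input bound, the others to multiples of `Z`; `1000` is a generous common constant. -/
theorem Params.Admissible.le_residual {p : Params} (hp : p.Admissible) (hL : 0 ≤ p.L)
    (hR : 1 ≤ p.R0) {ν : ℝ} (hν : 0 < ν) :
    12 * p.N * p.L * p.R0 ^ 2 * p.inputBound du ^ 2
      + 2 * p.L * p.c * p.R0 ^ 2 * p.inputBound du ^ 2
      + 7 * p.L * (p.Rnat * p.deviation du * p.T)
      + 7 / 2 * p.L * (12 * p.N * p.inputBound du ^ 2
        + (p.R0 * p.RM * p.ε) ^ 2 * (p.Rnat ^ 2 * p.T))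
      + 49 / 4 * p.L ^ 2 * (p.R0 * p.RM * p.ε) ^ 2 * (p.Rnat ^ 2 * p.T) / ν + p.L
      ≤ p.residual du 1000 ν := by
  have hU2 := hp.inputBound_sq_le du
  have hUn := hp.le_inputBound du
  have hT := hp.T_pos
  have hc := hp.one_le_c
  have hRM := hp.one_le_RM
  have hRn := hp.one_le_Rnat
  have hlog := hp.log_nonneg
  have hm : (1 : ℝ) ≤ p.m := Nat.one_le_cast.2 hp.one_le_m
  have hN : (1 : ℝ) ≤ p.N := Nat.one_le_cast.2 (hp.one_le_m.trans (by have := hp.N_ge; omega))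
  have hdu : (0 : ℝ) ≤ du := du.cast_nonneg
  have hUm : 2 * p.RM * p.Rnat ≤ p.inputBound du := le_max_right _ _
  set U := p.inputBound du with hU
  set Dd := (du : ℝ) + Real.log (1 / p.δ) + p.RM ^ 4 * p.Rnat ^ 2 with hDd
  have hD1 : 1 ≤ Dd := by
    have : 1 ≤ p.RM ^ 4 * p.Rnat ^ 2 :=
      one_le_mul_of_one_le_of_one_le (one_le_pow₀ hRM) (one_le_pow₀ hRn)
    linarith
  set W := p.L * p.R0 ^ 3 * Dd with hW
  have hW0 : 0 ≤ W := by positivity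
  have hLU2 : p.L * p.R0 ^ 2 * U ^ 2 ≤ 9 * W := by
    calc p.L * p.R0 ^ 2 * U ^ 2 ≤ p.L * p.R0 ^ 3 * (9 * Dd) := by
          gcongr
          norm_num
      _ = _ := by ring
  have hLU0 : p.L * U ^ 2 ≤ 9 * W := by
    refine le_trans ?_ hLU2
    rw [mul_assoc]
    refine mul_le_mul_of_nonneg_left ?_ hL
    exact le_mul_of_one_le_left (sq_nonneg _) (one_le_pow₀ hR)
  have hLW : p.L ≤ W := by
    calc p.L = p.L * 1 * 1 := by ring
      _ ≤ _ := by
        rw [hW]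
        gcongr
        exact one_le_pow₀ hR
  set Z := p.L * p.RM ^ 3 * p.R0 ^ 2 * p.Rnat ^ 2 * p.T * p.ε ^ 2 with hZ
  have hZ0 : 0 ≤ Z := by positivity
  have e3 : 7 * p.L * (p.Rnat * p.deviation du * p.T) =
      7 * p.L * p.R0 ^ 2 * p.c * (p.RM * p.Rnat * U)
        + 7 * (p.L * p.RM ^ 3 * p.R0 * p.Rnat ^ 2 * p.T * p.ε ^ 2) := by
    rw [Params.deviation, ← hU]
    field_simp
  have i3 : 7 * p.L * p.R0 ^ 2 * p.c * (p.RM * p.Rnat * U) ≤ 63 * (p.c * W) := by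
    have : p.RM * p.Rnat * U ≤ U ^ 2 := by
      have : 0 ≤ U := by linarith
      nlinarith
    calc _ ≤ 7 * p.L * p.R0 ^ 2 * p.c * U ^ 2 := by gcongr
      _ = 7 * p.c * (p.L * p.R0 ^ 2 * U ^ 2) := by ring
      _ ≤ 7 * p.c * (9 * W) := by gcongr
      _ = _ := by ring
  have i3' : p.L * p.RM ^ 3 * p.R0 * p.Rnat ^ 2 * p.T * p.ε ^ 2 ≤ Z := by
    rw [hZ]
    gcongr
    exact le_self_pow₀ hR two_ne_zero
  have hRM23 : p.RM ^ 2 ≤ p.RM ^ 3 := pow_le_pow_right₀ hRM (by norm_num)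
  have i4 : p.L * ((p.R0 * p.RM * p.ε) ^ 2 * (p.Rnat ^ 2 * p.T)) ≤ Z := by
    calc _ = p.L * p.RM ^ 2 * p.R0 ^ 2 * p.Rnat ^ 2 * p.T * p.ε ^ 2 := by ring
      _ ≤ Z := by rw [hZ]; gcongr
  have i5 : p.L ^ 2 * (p.R0 * p.RM * p.ε) ^ 2 * (p.Rnat ^ 2 * p.T) / ν ≤
      Z * (p.L * p.m * p.R0 ^ 2 / ν) := by
    have h1 : 1 ≤ p.m * p.R0 ^ 2 := one_le_mul_of_one_le_of_one_le hm (one_le_pow₀ hR)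
    calc _ = p.L * ((p.R0 * p.RM * p.ε) ^ 2 * (p.Rnat ^ 2 * p.T)) * (p.L * 1 / ν) := by ring
      _ ≤ Z * (p.L * (p.m * p.R0 ^ 2) / ν) := by gcongr
      _ = _ := by ring
  have hcm : p.c * W ≤ p.c * p.m * W := by
    have : 0 ≤ p.c * W := by positivity
    nlinarith
  have hNW : W ≤ p.N * W := le_mul_of_one_le_left hW0 hN
  have t1 : 12 * p.N * p.L * p.R0 ^ 2 * U ^ 2 ≤ 108 * (p.N * W) := by
    calc _ = 12 * p.N * (p.L * p.R0 ^ 2 * U ^ 2) := by ring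
      _ ≤ 12 * p.N * (9 * W) := by gcongr
      _ = _ := by ring
  have t2 : 2 * p.L * p.c * p.R0 ^ 2 * U ^ 2 ≤ 18 * (p.c * W) := by
    calc _ = 2 * p.c * (p.L * p.R0 ^ 2 * U ^ 2) := by ring
      _ ≤ 2 * p.c * (9 * W) := by gcongr
      _ = _ := by ring
  have t4 : p.L * (12 * p.N * U ^ 2) ≤ 108 * (p.N * W) := by
    calc _ = 12 * p.N * (p.L * U ^ 2) := by ring
      _ ≤ 12 * p.N * (9 * W) := by gcongr
      _ = _ := by ring
  have e6 : p.residual du 1000 ν = 1000 * (p.N * W) + 1000 * (p.c * p.m * W) + 1000 * Z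
      + 1000 * (Z * (p.L * p.m * p.R0 ^ 2 / ν)) := by
    rw [Params.residual, hW, hZ, hDd]
    ring
  have e5 : 49 / 4 * p.L ^ 2 * (p.R0 * p.RM * p.ε) ^ 2 * (p.Rnat ^ 2 * p.T) / ν =
      49 / 4 * (p.L ^ 2 * (p.R0 * p.RM * p.ε) ^ 2 * (p.Rnat ^ 2 * p.T) / ν) := by ring
  have hlast : 0 ≤ Z * (p.L * p.m * p.R0 ^ 2 / ν) := by positivity
  have hcmW : 0 ≤ p.c * W := by positivity
  rw [e6, e5, e3]
  linarith

/-- Without control inputs, every policy incurs the loss of nature's iterates. -/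
theorem controlRegret_eq_zero_of_dim_eq_zero {P : Instance dx ds dy 0 dη} {R : ℝ} {ψ : ℕ → ℝ}
    (h : (P.policyClass R ψ).Nonempty) (T : ℕ) (u : ℕ → Vec 0) :
    P.controlRegret T u (P.policyClass R ψ) = 0 := by
  have hz : ∀ x : ℕ → Vec 0, conv P.Gv x = 0 := fun x => by
    rw [Subsingleton.elim x 0]
    funext t
    simp [conv, act_zero]
  have h1 : (fun π => ∑ t ∈ range T, P.loss t (P.ldcV π t)) '' P.policyClass R ψ =
      {∑ t ∈ range T, P.loss t (P.vNat t)} := by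
    have h2 : ∀ π ∈ P.policyClass R ψ, ∑ t ∈ range T, P.loss t (P.ldcV π t) =
        ∑ t ∈ range T, P.loss t (P.vNat t) := by
      rintro π ⟨Gc, hGc, _⟩
      rw [P.ldcV_eq hGc, hz, add_zero]
    ext r
    constructor
    · rintro ⟨π, hπ, rfl⟩
      exact h2 π hπ
    · rintro rfl
      obtain ⟨π, hπ⟩ := h
      exact ⟨π, hπ, h2 π hπ⟩
  rw [Instance.controlRegret, h1, csInf_singleton, P.v_eq, hz, add_zero, sub_self]

/-! ### Assembly of the regret bound. -/

section Main

variable {P : Instance dx ds dy du dη} {p : Params} {ξ : ℕ → Vec du}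
  {Ghatη : ℕ → Matrix (Fin dη) (Fin du) ℝ} {M : ℕ → Fin p.m → Matrix (Fin du) (Fin dη) ℝ}

/-- From index `N + h` on, the last `h + 1` inputs all come from the iterates, so only the tail of
`Gv` separates the two arguments of the loss. Its mass is of order `1 / T`, so the sum over the
horizon stays bounded independently of `T`. -/
theorem sum_loss_v_sub_memLoss_le (hp : p.Admissible) (hP : P.Regular p) (hR : 1 ≤ p.R0)
    {u : ℕ → Vec du} (hu : ∀ t, ‖u t‖ ≤ p.inputBound du) {x : ℕ → Vec dη}
    (hux : ∀ t, p.N ≤ t → u t = drcInput (M t) x t)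
    {a : ℕ} (ha : p.N + p.h ≤ a) :
    ∑ t ∈ Ico a p.T, (P.loss t (P.v u t) - P.memLoss p.h x t (fun t => embed (M t))) ≤
      2 * p.L * p.c * p.R0 ^ 2 * p.inputBound du ^ 2 := by
  have hT := hp.T_pos
  have hL : 0 ≤ p.L := (hP.loss 0).nonneg_const
  have hc := hp.one_le_c
  have hRn := hp.one_le_Rnat
  have hUn := hp.le_inputBound du
  set U := p.inputBound du with hU
  have hRU : U ≤ p.R0 * U := le_mul_of_one_le_left (by linarith) hR
  have hB : 1 ≤ 2 * (p.R0 * U) := by linarith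
  have hθ : MassLe (tailFrom (p.h + 1) P.Gv) (p.c * p.R0 / p.T) :=
    massLe_tailFrom hP.Gv.summable ((hP.Gv.decay_le _).trans hp.ψ0_le)
  have key : ∀ t ∈ Ico a p.T, P.loss t (P.v u t) - P.memLoss p.h x t (fun t => embed (M t)) ≤
      p.L * (2 * (p.R0 * U)) * (p.c * p.R0 / p.T * U) := by
    intro t ht
    have hat := (mem_Ico.1 ht).1
    have e : conv (trunc (p.h + 1) P.Gv) (fun s => drcInput (M s) x s) t =
        conv (trunc (p.h + 1) P.Gv) u t := by
      rw [conv_eq_sum_range, conv_eq_sum_range]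
      refine sum_congr rfl fun i hi => ?_
      by_cases hi' : i < p.h + 1
      · rw [hux (t - i) (by omega)]
      · simp [trunc, hi', zero_act]
    rw [P.memLoss_embed, e, P.v_eq, Pi.add_apply]
    have b1 := norm_conv_le' hP.Gv.massLe hu t
    have b2 := norm_conv_le' (hP.Gv.massLe.trunc (p.h + 1)) hu t
    have b3 := hP.vNat_le t
    refine ((hP.loss t).sub_le_of_norm_le hB ((norm_add_le _ _).trans (by linarith))
      ((norm_add_le _ _).trans (by linarith))).trans ?_
    refine mul_le_mul_of_nonneg_left ?_ (by positivity)
    have e2 : P.vNat t + conv P.Gv u t - (P.vNat t + conv (trunc (p.h + 1) P.Gv) u t) =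
        conv (tailFrom (p.h + 1) P.Gv) u t := by
      have : conv P.Gv u t = conv (trunc (p.h + 1) P.Gv) u t + conv (tailFrom (p.h + 1) P.Gv) u t := by
        rw [← Pi.add_apply (conv _ u), ← add_conv, trunc_add_tailFrom]
      rw [this]
      abel
    rw [e2]
    exact norm_conv_le' hθ hu t
  have hU0 : 0 ≤ U := by linarith
  calc _ ≤ ∑ t ∈ Ico a p.T, p.L * (2 * (p.R0 * U)) * (p.c * p.R0 / p.T * U) := sum_le_sum key
    _ ≤ ∑ t ∈ range p.T, p.L * (2 * (p.R0 * U)) * (p.c * p.R0 / p.T * U) := by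
        refine sum_le_sum_of_subset_of_nonneg (fun t ht => ?_) fun t _ _ => by positivity
        exact mem_range.2 (mem_Ico.1 ht).2
    _ = _ := by
        rw [sum_const, card_range, nsmul_eq_mul]
        field_simp

theorem exists_controlRegret_le (hp : p.Admissible) (hP : P.Regular p)
    (hPi : (P.policyClass p.Rstar p.ψstar).Nonempty)
    (hM : ∀ t, M t ∈ drcClass du dη p.m p.RM) (hξ : GoodExploration p ξ)
    (hη : IsMarkovEstimate p.h p.ε P.Gη Ghatη) (u : ℕ → Vec du) (x : ℕ → Vec dη) (t₀ : ℕ)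
    (hu : u = P.algInput p.N ξ Ghatη M) (hx : x = P.ηHat Ghatη u)
    (ht₀ : t₀ = p.N + p.m + 2 * p.h) :
    ∃ zstar ∈ embed '' drcClass du dη p.m p.RM, ∀ ν : ℝ, 0 < ν →
      P.controlRegret p.T u (P.policyClass p.Rstar p.ψstar) ≤
        P.memoryRegret p.h t₀ p.T x (fun t => embed (M t)) zstar
        + ν * ∑ t ∈ Ico t₀ p.T, ‖embedY p.m du x t *ₑ (embed (M t) - zstar)‖ ^ 2
        + p.residual du 1000 ν := by
  have hL : 0 ≤ p.L := (hP.loss 0).nonneg_const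
  -- Without inputs `R0` may be less than `1`, but there is only one parameter and both regrets are
  -- zero.
  rcases eq_or_ne du 0 with rfl | hdu
  · refine ⟨embed (M 0), ⟨M 0, hM 0, rfl⟩, fun ν hν => ?_⟩
    have h0 : P.memoryRegret p.h t₀ p.T x (fun t => embed (M t)) (embed (M 0)) = 0 := by
      have : (fun t => embed (M t)) = fun _ => embed (M 0) := Subsingleton.elim _ _
      rw [Instance.memoryRegret, this, sub_self]
    rw [controlRegret_eq_zero_of_dim_eq_zero hPi, h0]
    have := hp.residual_nonneg (du := 0) hL hP.Gv.massLe.nonneg (by norm_num : (0 : ℝ) ≤ 1000) hν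
    positivity
  have hR : 1 ≤ p.R0 := one_le_of_isStableOperator_Gv hP.Gv hdu
  have hub : ∀ t, ‖u t‖ ≤ p.inputBound du := by
    rw [hu]; exact norm_algInput_le hp hP hξ hη hR hM
  have hxb : ∀ t, ‖x t‖ ≤ 2 * p.Rnat := fun t => by
    rw [hx]; exact norm_ηHat_le hp hP hξ hη hR fun j _ => hub j
  have hdrc : ∀ M' ∈ drcClass du dη p.m p.RM, ∀ t, ‖drcInput M' x t‖ ≤ p.inputBound du :=
    fun M' hM' t => (norm_drcInput_le hM' fun s _ => hxb s).trans
      (le_trans (le_of_eq (by ring)) (le_max_right _ _))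
  have hux : ∀ t, p.N ≤ t → u t = drcInput (M t) x t := fun t ht => by
    rw [hx, hu]; exact P.algInput_of_le ξ Ghatη M ht
  obtain ⟨π, hπ, hπle⟩ := exists_mem_sum_loss_le hP hPi
  obtain ⟨Ms, hMs, hcomp⟩ := exists_comparator hp hP hR hη (hξ.mul_le_one hp hR).1 hub hx hxb hπ t₀
  refine ⟨embed Ms, ⟨Ms, hMs, rfl⟩, fun ν hν => ?_⟩
  have hT := hp.T_pos
  have hUn := hp.le_inputBound du
  have hRn := hp.one_le_Rnat
  have hRM := hp.one_le_RM
  have hplay := sum_loss_v_sub_memLoss_le hp hP hR hub hux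
    (show p.N + p.h ≤ t₀ by omega)
  have hres := hp.le_residual (du := du) hL hR hν
  have hdev : 0 < p.deviation du := hp.deviation_pos hR
  set U := p.inputBound du with hU
  have hRU : U ≤ p.R0 * U := le_mul_of_one_le_left (by linarith) hR
  -- `m + h ≤ N` gives `N + m + 2 h ≤ 3 N`.
  have hmin : ((min t₀ p.T : ℕ) : ℝ) ≤ 3 * p.N := by
    have : min t₀ p.T ≤ 3 * p.N := by have := hp.N_ge; omega
    exact_mod_cast this
  have hstart : ∑ t ∈ range (min t₀ p.T), P.loss t (P.v u t) ≤
      12 * p.N * p.L * p.R0 ^ 2 * U ^ 2 := by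
    calc _ ≤ ∑ t ∈ range (min t₀ p.T), p.L * (2 * (p.R0 * U)) ^ 2 := by
          refine sum_le_sum fun t _ => (hP.loss t).le_of_norm_le (by linarith) ?_
          rw [P.v_eq, Pi.add_apply]
          have b1 := norm_conv_le' hP.Gv.massLe hub t
          have b3 := hP.vNat_le t
          exact (norm_add_le _ _).trans (by linarith)
      _ = (min t₀ p.T : ℕ) * (p.L * (2 * (p.R0 * U)) ^ 2) := by
          rw [sum_const, card_range, nsmul_eq_mul]
      _ ≤ 3 * p.N * (p.L * (2 * (p.R0 * U)) ^ 2) := by gcongr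
      _ = _ := by ring
  -- After exploration the played input is `𝐘_t z_t`, so the curvature sum is the late part of the
  -- input distance.
  have hYeq : ∑ t ∈ Ico t₀ p.T, ‖embedY p.m du x t *ₑ (embed (M t) - embed Ms)‖ ^ 2 =
      ∑ t ∈ Ico t₀ p.T, ‖u t - drcInput Ms x t‖ ^ 2 := by
    refine sum_congr rfl fun t ht => ?_
    rw [act_sub, embedY_act_embed, embedY_act_embed, ← hux t (by have := (mem_Ico.1 ht).1; omega)]
  set Y := ∑ t ∈ Ico t₀ p.T, ‖u t - drcInput Ms x t‖ ^ 2 with hY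
  set X := ∑ t ∈ range (min t₀ p.T), ‖u t - drcInput Ms x t‖ ^ 2 with hX
  have hXY : inputDist p.T u x Ms = X + Y := sum_range_eq_add_sum_Ico _ _ _
  have hX0 : 0 ≤ X := sum_nonneg fun _ _ => sq_nonneg _
  have hY0 : 0 ≤ Y := sum_nonneg fun _ _ => sq_nonneg _
  have hXle : X ≤ 12 * p.N * U ^ 2 := by
    calc X ≤ ∑ t ∈ range (min t₀ p.T), (2 * U) ^ 2 := by
          refine sum_le_sum fun t _ => pow_le_pow_left₀ (norm_nonneg _) ?_ 2
          have := hdrc Ms hMs t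
          exact (norm_sub_le _ _).trans (by linarith [hub t])
      _ = (min t₀ p.T : ℕ) * (2 * U) ^ 2 := by rw [sum_const, card_range, nsmul_eq_mul]
      _ ≤ 3 * p.N * (2 * U) ^ 2 := by gcongr
      _ = _ := by ring
  have hsq : √(p.Rnat ^ 2 * p.T) * (p.deviation du * √p.T) = p.Rnat * p.deviation du * p.T := by
    rw [Real.sqrt_mul (sq_nonneg _), Real.sqrt_sq (by linarith)]
    calc _ = p.Rnat * p.deviation du * (√p.T * √p.T) := by ring
      _ = _ := by rw [Real.mul_self_sqrt hT.le]
  -- `X` is the early input distance, bounded outright; `Y` is the late one, paid for by the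
  -- curvature term.
  have hsplit := sqrt_mul_le_of_split (S := p.Rnat ^ 2 * p.T) (A := p.deviation du * √p.T)
    (κ := p.R0 * p.RM * p.ε) (X := X) (Y := Y) (L := p.L) (ν := ν)
    (Q := p.deviation du ^ 2 * p.T + (p.R0 * p.RM * p.ε) ^ 2 * (X + Y))
    (by positivity) (by positivity) hX0 hY0 hL hν
    (by rw [mul_pow (p.deviation du), Real.sq_sqrt hT.le])
  rw [hsq] at hsplit
  rw [hXY] at hcomp
  have hXL : 7 / 2 * p.L * (X + (p.R0 * p.RM * p.ε) ^ 2 * (p.Rnat ^ 2 * p.T)) ≤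
      7 / 2 * p.L * (12 * p.N * U ^ 2 + (p.R0 * p.RM * p.ε) ^ 2 * (p.Rnat ^ 2 * p.T)) := by
    gcongr
  have hπ0 : 0 ≤ ∑ t ∈ range (min t₀ p.T), P.loss t (P.ldcV π t) :=
    sum_nonneg fun t _ => (hP.loss t).nonneg _
  rw [hYeq, Instance.controlRegret, Instance.memoryRegret]
  have s1 := sum_range_eq_add_sum_Ico (fun t => P.loss t (P.v u t)) t₀ p.T
  have s2 := sum_range_eq_add_sum_Ico (fun t => P.loss t (P.ldcV π t)) t₀ p.T
  rw [sum_sub_distrib] at hplay hcomp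
  linarith

end Main

end NonstochasticControl

end

open NonstochasticControl in
theorem mainTheorem8 :
    ∃ K₀ : ℝ, 0 < K₀ ∧
      -- dynamic nominal controller
      (∀ (dx ds dy du dη : ℕ) (P : Instance dx ds dy du dη) (p : Params)
        (ξ : ℕ → Vec du)
        (Ghatv : ℕ → Matrix (Fin dy ⊕ Fin du) (Fin du) ℝ)
        (Ghatη : ℕ → Matrix (Fin dη) (Fin du) ℝ)
        (M : ℕ → Fin p.m → Matrix (Fin du) (Fin dη) ℝ),
        p.Admissible → P.Regular p →
        (P.policyClass p.Rstar p.ψstar).Nonempty →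
        (∀ t, M t ∈ drcClass du dη p.m p.RM) →
        GoodExploration p ξ →
        IsMarkovEstimate p.h p.ε P.Gv Ghatv →
        IsMarkovEstimate p.h p.ε P.Gη Ghatη →
        ∀ (uex : ℕ → Vec du) (ηhat : ℕ → Vec dη) (t₀ : ℕ),
        uex = P.algInput p.N ξ Ghatη M →
        ηhat = P.ηHat Ghatη uex →
        t₀ = p.N + p.m + 2 * p.h →
        ∃ zstar ∈ embed '' drcClass du dη p.m p.RM, ∀ ν : ℝ, 0 < ν →
          P.controlRegret p.T uex (P.policyClass p.Rstar p.ψstar) ≤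
            P.memoryRegret p.h t₀ p.T ηhat (fun t => embed (M t)) zstar
            + ν * ∑ t ∈ Finset.Ico t₀ p.T,
                ‖embedY p.m du ηhat t *ₑ (embed (M t) - zstar)‖ ^ 2
            + K₀ * (p.L * p.R0 ^ 3 * (p.N + p.c * p.m))
                * (du + Real.log (1 / p.δ) + p.RM ^ 4 * p.Rnat ^ 2)
            + K₀ * (p.L * p.RM ^ 3 * p.R0 ^ 2 * p.Rnat ^ 2 * p.T * p.ε ^ 2)
                * (1 + p.L * p.m * p.R0 ^ 2 / ν)) ∧
      -- static nominal controller: one estimate `Ghat` of `G_K`, whose `y`-rows reconstruct `y^K`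
      (∀ (dx dy du : ℕ) (K : Matrix (Fin du) (Fin dy) ℝ) (P : Instance dx 0 dy du dy) (p : Params)
        (ξ : ℕ → Vec du)
        (Ghat : ℕ → Matrix (Fin dy ⊕ Fin du) (Fin du) ℝ)
        (M : ℕ → Fin p.m → Matrix (Fin du) (Fin dy) ℝ),
        P.ctrl = NominalController.static K →
        p.Admissible → P.Regular p →
        (P.policyClass p.Rstar p.ψstar).Nonempty →
        (∀ t, M t ∈ drcClass du dy p.m p.RM) →
        GoodExploration p ξ →
        IsMarkovEstimate p.h p.ε P.Gv Ghat →
        ∀ (uex : ℕ → Vec du) (ηhat : ℕ → Vec dy) (t₀ : ℕ),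
        uex = P.algInput p.N ξ (fun i => (Ghat i).toRows₁) M →
        ηhat = P.ηHat (fun i => (Ghat i).toRows₁) uex →
        t₀ = p.N + p.m + 2 * p.h →
        ∃ zstar ∈ embed '' drcClass du dy p.m p.RM, ∀ ν : ℝ, 0 < ν →
          P.controlRegret p.T uex (P.policyClass p.Rstar p.ψstar) ≤
            P.memoryRegret p.h t₀ p.T ηhat (fun t => embed (M t)) zstar
            + ν * ∑ t ∈ Finset.Ico t₀ p.T,
                ‖embedY p.m du ηhat t *ₑ (embed (M t) - zstar)‖ ^ 2
            + K₀ * (p.L * p.R0 ^ 3 * (p.N + p.c * p.m))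
                * (du + Real.log (1 / p.δ) + p.RM ^ 4 * p.Rnat ^ 2)
            + K₀ * (p.L * p.RM ^ 3 * p.R0 ^ 2 * p.Rnat ^ 2 * p.T * p.ε ^ 2)
                * (1 + p.L * p.m * p.R0 ^ 2 / ν)) := by
  refine ⟨1000, by norm_num, ?_, ?_⟩
  · intro dx ds dy du dη P p ξ Ghatv Ghatη M hp hP hPi hM hξ _ hη uex ηhat t₀ huex hηhat ht₀
    obtain ⟨z, hz, h⟩ := exists_controlRegret_le hp hP hPi hM hξ hη uex ηhat t₀ huex hηhat ht₀
    exact ⟨z, hz, fun ν hν => (h ν hν).trans_eq (add_assoc _ _ _).symm⟩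
  · intro dx dy du K P p ξ Ghat M hK hp hP hPi hM hξ hG uex ηhat t₀ huex hηhat ht₀
    -- Here `η = y`, so `Gη` consists of the `y`-rows of `Gv`; taking these rows does not increase
    -- the operator norm of the error.
    have hη : IsMarkovEstimate p.h p.ε P.Gη (fun i => (Ghat i).toRows₁) := by
      rw [show P.Gη = fun i => (P.Gv i).toRows₁ from funext (Gη_static P hK)]
      exact isMarkovEstimate_toRows₁ hG
    obtain ⟨z, hz, h⟩ := exists_controlRegret_le hp hP hPi hM hξ hη uex ηhat t₀ huex hηhat ht₀
    exact ⟨z, hz, fun ν hν => (h ν hν).trans_eq (add_assoc _ _ _).symm⟩
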